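/- Let $\Omega=(0,1)^2$, $k>0$, and let $\mathcal B_1,\mathcal B_3\in\{\mathrm{id},\partial/\partial\nu\}$ be boundary operators on $\Gamma_1=(0,1)\times\{0\}$ and $\Gamma_3=(0,1)\times\{1\}$, where $\nu$ is the outward unit normal (so $\partial/\partial\nu=-\partial_y$ on $\Gamma_1$ and $\partial/\partial\nu=\partial_y$ on $\Gamma_3$; for functions of $y\in[0,1]$, $-d/dy$ at $0$ and $d/dy$ at $1$). Put $d_0=\inf_{m\in\mathbb Z}|k^2-m\pi^2|$ and, for $n\in\mathbb N_0=\{0,1,2,\dots\}$, choose $$\tilde\mu_n=\begin{cases}(n+\frac12)\pi,&\mathcal B_1=\mathcal B_3,\ d_0\in[0,\frac18\pi^2],\\ n\pi,&\mathcal B_1=\mathcal B_3,\ d_0\notin[0,\frac18\pi^2],\\ n\pi,&\mathcal B_1\neq\mathcal B_3,\ d_0\in[0,\frac18\pi^2]\cup[\frac38\pi^2,\frac12\pi^2],\\ (n+\frac12)\pi,&\mathcal B_1\neq\mathcal B_3,\ d_0\notin[0,\frac18\pi^2]\cup[\frac38\pi^2,\frac12\pi^2].\end{cases}$$ If $\tilde\mu_n=n\pi$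 for all $n$, let $\{\tilde X_n\}_{n\ge0}$ be either $\tilde X_n(x)=\sqrt2\sin(n\pi x)$ (with $\tilde X_0=0$) or $\tilde X_0=1$, $\tilde X_n(x)=\sqrt2\cos(n\pi x)$ for $n\ge1$; if $\tilde\mu_n=(n+\frac12)\pi$ for all $n$, let it be either $\tilde X_n(x)=\sqrt2\sin((n+\frac12)\pi x)$ or $\tilde X_n(x)=\sqrt2\cos((n+\frac12)\pi x)$. For complex-valued $g_1\in L^2(\Gamma_1)$ set $\hat g_1(n)=\int_0^1 g_1(x)\tilde X_n(x)\,dx$, and for $s\ge0$ write $g_1\in\mathcal X^{s}(\Gamma_1)$ if $g_1\in L^2(\Gamma_1)$ and $\sum_{n\ge0}|\hat g_1(n)|^2\tilde\mu_n^{2s}<\infty$. Assume $g_1\in\mathcal X^{1/2}(\Gamma_1)$ if $\mathcal B_1=\partial/\partial\nu$, and $g_1\in\mathcal X^{3/2}(\Gamma_1)$ if $\mathcal B_1=\mathrm{id}$. Then for every $n\ge0$ the boundary value problem $$\tilde Y_n''+(k^2-\tilde\mu_n^2)\tilde Y_n=0\ \text{ in }(0,1),\qquad \mathcal B_1\tilde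 Y_n(0)=1,\quad \mathcal B_3\tilde Y_n(1)=0$$ has exactly one solution $\tilde Y_n$ in $C^1([0,1])\cap C^2((0,1))$, and the series $$\tilde u(x,y)=\sum_{n=0}^\infty \hat g_1(n)\,\tilde X_n(x)\,\tilde Y_n(y)$$ converges absolutely at each point of $[0,1]^2$ and also in $H^1(\Omega)$. Moreover $\tilde u\in H^1(\Omega)$; its first order weak derivatives $\tilde u_x,\tilde u_y$ also belong to $H^1(\Omega)$ and $$\Delta\tilde u+k^2\tilde u=0\ \text{ a.e. in }\Omega,\qquad \mathcal B_1\tilde u=g_1\ \text{ on }\Gamma_1,\qquad \mathcal B_3\tilde u=0\ \text{ on }\Gamma_3,$$ where the boundary values of $\tilde u$ and $\pm\tilde u_y$ are taken in the sense of the $H^1(\Omega)$ trace and the boundary conditions hold a.e. Finally, the trace of $\tilde u$ on $\partial\Omega$ belongs to $H^{1/2}(\partial\Omega)$, and the trace of $\tilde u_x$ on $\partial\Omega$ belongs to $L^2(\partial\Omega)$. -/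

import Mathlib

open MeasureTheory Set Filter
open scoped Topology ContDiff

namespace HelmholtzLifting

noncomputable section

/-! ### Boundary operators and the one-dimensional data -/

/-- The two boundary operators allowed on the horizontal sides: `B u = u` and `B u = ∂u/∂ν`. -/
inductive HorizontalBC
  | dirichlet
  | neumann

/-- The value of `B u`, given the boundary value of `u` and that of its outward normal
derivative. -/
def HorizontalBC.eval (B : HorizontalBC) (value normalDeriv : ℂ) : ℂ :=
  match B with
  | .dirichlet => value
  | .neumann => normalDeriv

/-- `dist (k², π² ℤ)`. -/
def distLattice (k : ℝ) : ℝ := ⨅ n : ℤ, |k ^ 2 - (n : ℝ) * Real.pi ^ 2|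

open scoped Classical in
/-- The frequencies `μ̃ₙ`, chosen by the four-case rule. -/
def liftFreq (k : ℝ) (B₁ B₃ : HorizontalBC) (n : ℕ) : ℝ :=
  if B₁ = B₃ then
    if distLattice k ∈ Icc 0 (1 / 8 * Real.pi ^ 2) then
      ((n : ℝ) + 1 / 2) * Real.pi
    else
      (n : ℝ) * Real.pi
  else
    if distLattice k ∈ Icc 0 (1 / 8 * Real.pi ^ 2) ∪
        Icc (3 / 8 * Real.pi ^ 2) (1 / 2 * Real.pi ^ 2) then
      (n : ℝ) * Real.pi
    else
      ((n : ℝ) + 1 / 2) * Real.pi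

/-- `√2 sin(nπx)`; the member `n = 0` is the zero function, a harmless placeholder. -/
def Z₁ (n : ℕ) (x : ℝ) : ℝ := √2 * Real.sin ((n : ℝ) * Real.pi * x)

/-- `1` for `n = 0`, and `√2 cos(nπx)` for `n ≥ 1`. -/
def Z₂ (n : ℕ) (x : ℝ) : ℝ := if n = 0 then 1 else √2 * Real.cos ((n : ℝ) * Real.pi * x)

/-- `√2 sin((n+1/2)πx)`. -/
def Z₃ (n : ℕ) (x : ℝ) : ℝ := √2 * Real.sin (((n : ℝ) + 1 / 2) * Real.pi * x)

/-- `√2 cos((n+1/2)πx)`. -/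
def Z₄ (n : ℕ) (x : ℝ) : ℝ := √2 * Real.cos (((n : ℝ) + 1 / 2) * Real.pi * x)

/-- `X` is one of the two orthonormal bases of `L²(0,1)` that belong to the frequencies `μ`. -/
def IsEigenbasis (μ : ℕ → ℝ) (X : ℕ → ℝ → ℝ) : Prop :=
  ((∀ n, μ n = (n : ℝ) * Real.pi) ∧ (X = Z₁ ∨ X = Z₂)) ∨
  ((∀ n, μ n = ((n : ℝ) + 1 / 2) * Real.pi) ∧ (X = Z₃ ∨ X = Z₄))

/-- The coefficient `ĝ(n) = ∫₀¹ g(x) Xₙ(x) dx`. -/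
def coeff (X : ℕ → ℝ → ℝ) (g : ℝ → ℂ) (n : ℕ) : ℂ :=
  ∫ x in Ioo (0 : ℝ) 1, g x * (X n x : ℂ)

/-- The space `𝒳ˢ`: `g ∈ L²(0,1)` and `∑ |ĝ(n)|² μₙ^{2s} < ∞`. -/
def MemX (μ : ℕ → ℝ) (X : ℕ → ℝ → ℝ) (s : ℝ) (g : ℝ → ℂ) : Prop :=
  MemLp g 2 (volume.restrict (Ioo (0 : ℝ) 1)) ∧
    Summable fun n : ℕ => ‖coeff X g n‖ ^ 2 * μ n ^ (2 * s)

/-- `Y` (on `[0,1]`) solves `Y'' + (k² - μ²) Y = 0` in `(0,1)`, `B₁ Y(0) = 1`, `B₃ Y(1) = 0`.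
Here `Y'` is the derivative of `Y`, continuous up to the end points; the outward normal derivative
is `-Y'(0)` at `0` and `Y'(1)` at `1`. -/
def IsProfile (k μ : ℝ) (B₁ B₃ : HorizontalBC) (Y : ℝ → ℂ) : Prop :=
  ∃ Y' : ℝ → ℂ,
    ContinuousOn Y' (Icc 0 1) ∧
    (∀ y ∈ Icc (0 : ℝ) 1, HasDerivWithinAt Y (Y' y) (Icc 0 1) y) ∧
    (∀ y ∈ Ioo (0 : ℝ) 1, HasDerivAt Y' (-(((k ^ 2 - μ ^ 2 : ℝ) : ℂ) * Y y)) y) ∧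
    B₁.eval (Y 0) (-(Y' 0)) = 1 ∧
    B₃.eval (Y 1) (Y' 1) = 0

/-! ### Sobolev spaces and traces on the unit square -/

/-- `Ω = (0,1)²`. -/
def Ω : Set (ℝ × ℝ) := Ioo 0 1 ×ˢ Ioo 0 1

/-- Lebesgue measure on `Ω`. -/
def areaΩ : Measure (ℝ × ℝ) := volume.restrict Ω

/-- Arc length on `∂Ω`: the sum of the length measures of the four sides. -/
def arcΩ : Measure (ℝ × ℝ) :=
  (volume.restrict (Ioo (0 : ℝ) 1)).map (fun t => (t, (0 : ℝ))) +
  (volume.restrict (Ioo (0 : ℝ) 1)).map (fun t => ((1 : ℝ), t)) +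
  (volume.restrict (Ioo (0 : ℝ) 1)).map (fun t => (t, (1 : ℝ))) +
  (volume.restrict (Ioo (0 : ℝ) 1)).map (fun t => ((0 : ℝ), t))

/-- `v` is the weak derivative of `u` in `Ω` in the direction `e` (used for `u, v ∈ L²(Ω)`). -/
def IsWeakDeriv (e : ℝ × ℝ) (u v : ℝ × ℝ → ℂ) : Prop :=
  ∀ φ : ℝ × ℝ → ℝ, ContDiff ℝ ∞ φ → HasCompactSupport φ → tsupport φ ⊆ Ω →
    ∫ p, fderiv ℝ φ p e • u p ∂areaΩ = -∫ p, φ p • v p ∂areaΩ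

/-- `u ∈ H¹(Ω)`, with weak gradient `(ux, uy)`. -/
structure HasH1Gradient (u ux uy : ℝ × ℝ → ℂ) : Prop where
  memLp : MemLp u 2 areaΩ
  memLp_x : MemLp ux 2 areaΩ
  memLp_y : MemLp uy 2 areaΩ
  weak_x : IsWeakDeriv (1, 0) u ux
  weak_y : IsWeakDeriv (0, 1) u uy

/-- `u ∈ H¹(Ω)`. -/
def MemH1 (u : ℝ × ℝ → ℂ) : Prop := ∃ ux uy, HasH1Gradient u ux uy

/-- The functions `vₘ`, with classical gradients, converge in the `H¹(Ω)` norm to the function `u`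
with weak gradient `(ux, uy)`. -/
def TendstoH1 (v : ℕ → ℝ × ℝ → ℂ) (u ux uy : ℝ × ℝ → ℂ) : Prop :=
  Tendsto (fun m => eLpNorm (fun p => v m p - u p) 2 areaΩ) atTop (𝓝 0) ∧
  Tendsto (fun m => eLpNorm (fun p => fderiv ℝ (v m) p (1, 0) - ux p) 2 areaΩ) atTop (𝓝 0) ∧
  Tendsto (fun m => eLpNorm (fun p => fderiv ℝ (v m) p (0, 1) - uy p) 2 areaΩ) atTop (𝓝 0)

/-- `φ` is the trace on `∂Ω` of `u ∈ H¹(Ω)`: the extension by continuity of the restriction map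
from functions smooth up to the boundary, from the `H¹(Ω)` norm to the `L²(∂Ω)` norm. -/
def IsTrace (u φ : ℝ × ℝ → ℂ) : Prop :=
  ∃ ux uy, HasH1Gradient u ux uy ∧ AEStronglyMeasurable φ arcΩ ∧
    ∃ v : ℕ → ℝ × ℝ → ℂ, (∀ m, ContDiff ℝ ∞ (v m)) ∧
      TendstoH1 v u ux uy ∧
      Tendsto (fun m => eLpNorm (fun p => v m p - φ p) 2 arcΩ) atTop (𝓝 0)

/-- `φ ∈ H^{1/2}(∂Ω)`, by the Sobolev–Slobodeckij (Gagliardo) norm, with `|p - q|` the Euclidean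
distance. -/
def MemHHalf (φ : ℝ × ℝ → ℂ) : Prop :=
  MemLp φ 2 arcΩ ∧
    ∫⁻ p, ∫⁻ q, ENNReal.ofReal
      (‖φ p - φ q‖ ^ 2 / ((p.1 - q.1) ^ 2 + (p.2 - q.2) ^ 2)) ∂arcΩ ∂arcΩ < ⊤

/-! ### The series -/

/-- The `n`-th term `ĝ(n) Xₙ(x) Yₙ(y)`. -/
def liftTerm (X : ℕ → ℝ → ℝ) (Y : ℕ → ℝ → ℂ) (g : ℝ → ℂ) (n : ℕ) (p : ℝ × ℝ) : ℂ :=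
  coeff X g n * (X n p.1 : ℂ) * Y n p.2

/-- The partial sum of the first `M` terms. -/
def liftPartial (X : ℕ → ℝ → ℝ) (Y : ℕ → ℝ → ℂ) (g : ℝ → ℂ) (M : ℕ) (p : ℝ × ℝ) : ℂ :=
  ∑ n ∈ Finset.range M, liftTerm X Y g n p

/-- The lifting `ũ(x,y) = ∑ₙ ĝ(n) Xₙ(x) Yₙ(y)`. -/
def liftSum (X : ℕ → ℝ → ℝ) (Y : ℕ → ℝ → ℂ) (g : ℝ → ℂ) (p : ℝ × ℝ) : ℂ :=
  ∑' n, liftTerm X Y g n p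

end

end HelmholtzLifting

open HelmholtzLifting

/-! The chosen frequencies avoid resonance. If `k² - μ̃ₙ²` were an eigenvalue of `-d²/dy²` under
`B₁`, `B₃`, then `k²/π²` would be an integer plus 0, 1/4 or 1/2, depending on which of `μ̃ₙ` and the
eigenvalue carry half-integers. This fixes `distLattice k` exactly, and the four-case rule excludes
that value (`isNonresonant_liftFreq`). Each profile is therefore a quotient of hyperbolic functions
(with a complex argument when `k² > μ̃ₙ²`, affine or constant in the degenerate case), and it is
unique (`IsFundamental.eqOn_of_isProfile`).

For large `n`, put `λ = √(μ̃ₙ² - k²)`. The profile is bounded by a multiple of `ρ e^{-λy}`, where `ρ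
= 1` (Dirichlet at 0) or `1/λ` (Neumann), and each derivative costs a factor `λ`. Integrating the
squared exponential gains `1/λ`, so the squared `H²(Ω)` norm of the `n`-th term is at most a
constant times `|ĝ(n)|² ρ² λ³`. The hypotheses `g₁ ∈ 𝒳^{3/2}` and `g₁ ∈ 𝒳^{1/2}` say exactly that
these weights are summable (`exists_weight`). The `Xₙ` are orthogonal in `x`, and so are their
normalized derivatives `Dₙ`, so the series and its termwise derivatives up to second order converge
in `L²(Ω)` (`exists_approxH2`). The partial sums are smooth, hence the limits are weak derivatives,
and the Helmholtz equation passes from the terms to the limit.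

Traces come from the one-dimensional Sobolev inequality, applied on every horizontal and vertical
segment (`lineBound_enorm_sq`). On `Γ₁` the partial sums of `B₁ ũ` are the expansion of `g₁`, which
converges to `g₁` because the trigonometric family is complete (`IsCosineModule.ae_eq_zero`, by
Weierstrass approximation). On `Γ₃` they vanish.

For the `H^{1/2}` bound, the Gagliardo quotient of a smooth `v` is at most the mean of `|∇v|²` along
the chord from `q` to `p`. Integrating over both boundary points reduces this to integrals of
`|∇v|²` over segments parallel to the sides, which are bounded since `∇ũ` is itself in `H¹(Ω)`.
Fatou's lemma carries the bound to the limit. -/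

/-! ### Trigonometric systems: orthogonality and normalization -/

/-- `X` and `D` are two families of trigonometric functions with `Xₙ' = μₙ Dₙ`, `Dₙ' = -μₙ Xₙ`, the
same boundary condition at each end point for all `n`, and distinct frequencies. -/
structure TrigSystem (μ : ℕ → ℝ) (X D : ℕ → ℝ → ℝ) : Prop where
  deriv_fst : ∀ n x, HasDerivAt (X n) (μ n * D n x) x
  deriv_snd : ∀ n x, HasDerivAt (D n) (-(μ n * X n x)) x
  left : (∀ n, X n 0 = 0) ∨ (∀ n, D n 0 = 0)
  right : (∀ n, X n 1 = 0) ∨ (∀ n, D n 1 = 0)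
  abs_fst_le : ∀ n x, |X n x| ≤ 2
  abs_snd_le : ∀ n x, |D n x| ≤ 2
  contDiff_fst : ∀ n, ContDiff ℝ ∞ (X n)
  contDiff_snd : ∀ n, ContDiff ℝ ∞ (D n)
  sq_ne : ∀ n m, n ≠ m → μ n ^ 2 ≠ μ m ^ 2

/-- The minus sign of `Dₙ' = -μₙ Xₙ` is absorbed into the frequency. Results about `X` then apply to
`D`, which carries the `x`-derivative of the series. -/
theorem TrigSystem.swap {μ : ℕ → ℝ} {X D : ℕ → ℝ → ℝ} (h : TrigSystem μ X D) :
    TrigSystem (fun n => -μ n) D X where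
  deriv_fst n x := by simpa using h.deriv_snd n x
  deriv_snd n x := by simpa using h.deriv_fst n x
  left := h.left.symm
  right := h.right.symm
  abs_fst_le := h.abs_snd_le
  abs_snd_le := h.abs_fst_le
  contDiff_fst := h.contDiff_snd
  contDiff_snd := h.contDiff_fst
  sq_ne n m hnm := by simpa using h.sq_ne n m hnm

theorem setIntegral_Ioo_eq_intervalIntegral {E : Type*} [NormedAddCommGroup E] [NormedSpace ℝ E]
    (f : ℝ → E) : ∫ x in Ioo (0 : ℝ) 1, f x = ∫ x in (0 : ℝ)..1, f x := by
  rw [intervalIntegral.integral_of_le zero_le_one, integral_Ioc_eq_integral_Ioo]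

/-- Sturm–Liouville orthogonality. -/
theorem TrigSystem.integral_mul_eq_zero {μ : ℕ → ℝ} {X D : ℕ → ℝ → ℝ} (h : TrigSystem μ X D)
    {n m : ℕ} (hnm : n ≠ m) : ∫ x in Ioo (0 : ℝ) 1, X n x * X m x = 0 := by
  have hd : ∀ x, HasDerivAt (fun x => μ m * (X n x * D m x) - μ n * (D n x * X m x))
      ((μ n ^ 2 - μ m ^ 2) * (X n x * X m x)) x := by
    intro x
    have := (((h.deriv_fst n x).mul (h.deriv_snd m x)).const_mul (μ m)).sub
      (((h.deriv_snd n x).mul (h.deriv_fst m x)).const_mul (μ n))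
    refine this.congr_deriv ?_
    ring
  have hc : Continuous fun x => (μ n ^ 2 - μ m ^ 2) * (X n x * X m x) :=
    continuous_const.mul ((h.contDiff_fst n).continuous.mul (h.contDiff_fst m).continuous)
  have := intervalIntegral.integral_eq_sub_of_hasDerivAt (a := 0) (b := 1) (fun x _ => hd x)
    (hc.intervalIntegrable 0 1)
  rw [intervalIntegral.integral_const_mul] at this
  have h0 : μ m * (X n 0 * D m 0) - μ n * (D n 0 * X m 0) = 0 := by
    rcases h.left with h | h <;> simp [h]
  have h1 : μ m * (X n 1 * D m 1) - μ n * (D n 1 * X m 1) = 0 := by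
    rcases h.right with h | h <;> simp [h]
  rw [h0, h1, sub_zero] at this
  rw [setIntegral_Ioo_eq_intervalIntegral]
  exact (mul_eq_zero.1 this).resolve_left (sub_ne_zero.2 (h.sq_ne n m hnm))

/-- Since `(X D)' = μ (D² - X²) = 2μ (1 - X²)`, a primitive of `2μ X²` is `2μ x - X D`, and `X D`
vanishes at both end points. -/
theorem TrigSystem.integral_sq_eq_one {μ : ℕ → ℝ} {X D : ℕ → ℝ → ℝ} (h : TrigSystem μ X D)
    {n : ℕ} (hμ : μ n ≠ 0) (hXD : ∀ x, X n x ^ 2 + D n x ^ 2 = 2) :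
    ∫ x in Ioo (0 : ℝ) 1, X n x * X n x = 1 := by
  have hd : ∀ x, HasDerivAt (fun x => 2 * μ n * x - X n x * D n x)
      (2 * μ n * (X n x * X n x)) x := by
    intro x
    have := ((hasDerivAt_id x).const_mul (2 * μ n)).sub ((h.deriv_fst n x).mul (h.deriv_snd n x))
    refine this.congr_deriv ?_
    simp only [mul_one]
    linear_combination -μ n * hXD x
  have hc : Continuous fun x => 2 * μ n * (X n x * X n x) :=
    continuous_const.mul ((h.contDiff_fst n).continuous.mul (h.contDiff_fst n).continuous)
  have := intervalIntegral.integral_eq_sub_of_hasDerivAt (a := 0) (b := 1) (fun x _ => hd x)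
    (hc.intervalIntegrable 0 1)
  rw [intervalIntegral.integral_const_mul] at this
  have h0 : X n 0 * D n 0 = 0 := by
    rcases h.left with h | h <;> simp [h]
  have h1 : X n 1 * D n 1 = 0 := by
    rcases h.right with h | h <;> simp [h]
  rw [h0, h1] at this
  rw [setIntegral_Ioo_eq_intervalIntegral]
  have h2 : (2 * μ n) ≠ 0 := by simpa using hμ
  apply mul_left_cancel₀ h2
  linarith

/-! ### The four bases as modules over polynomials in `cos(πx)` -/

/-- The algebraic properties that make a family of trigonometric functions complete in
`L²(0,1)`. -/
structure IsCosineModule (X : ℕ → ℝ → ℝ) : Prop where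
  cos_mul : ∀ n, ∃ (a b : ℝ) (m l : ℕ), ∀ x, X n x * Real.cos (Real.pi * x) = a * X m x + b * X l x
  exists_ne_zero : ∃ n, ∀ x ∈ Ioo (0 : ℝ) 1, X n x ≠ 0
  normalized : ∀ n, X n = 0 ∨ ∫ x in Ioo (0 : ℝ) 1, X n x * X n x = 1

theorem hasDerivAt_sqrt_two_mul_sin (a x : ℝ) :
    HasDerivAt (fun x => √2 * Real.sin (a * x)) (a * (√2 * Real.cos (a * x))) x := by
  have := (((hasDerivAt_id x).const_mul a).sin).const_mul √2
  refine this.congr_deriv ?_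
  simp only [mul_one, id]
  ring

theorem hasDerivAt_sqrt_two_mul_cos (a x : ℝ) :
    HasDerivAt (fun x => √2 * Real.cos (a * x)) (-(a * (√2 * Real.sin (a * x)))) x := by
  have := (((hasDerivAt_id x).const_mul a).cos).const_mul √2
  refine this.congr_deriv ?_
  simp only [mul_one, id]
  ring

theorem abs_sqrt_two_mul_le {t : ℝ} (ht : |t| ≤ 1) : |√2 * t| ≤ 2 := by
  rw [abs_mul, abs_of_nonneg (Real.sqrt_nonneg 2)]
  have : √2 ≤ 2 := by
    rw [Real.sqrt_le_left] <;> norm_num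
  nlinarith [abs_nonneg t, Real.sqrt_nonneg 2]

theorem hasDerivAt_Z₁ (n : ℕ) (x : ℝ) :
    HasDerivAt (Z₁ n) ((n : ℝ) * Real.pi * Z₂ n x) x := by
  rcases eq_or_ne n 0 with rfl | hn
  · have : Z₁ 0 = fun _ => 0 := by ext; simp [Z₁]
    rw [this]; simpa using hasDerivAt_const x (0 : ℝ)
  · have : Z₂ n x = √2 * Real.cos ((n : ℝ) * Real.pi * x) := by simp [Z₂, hn]
    rw [this]
    exact hasDerivAt_sqrt_two_mul_sin ((n : ℝ) * Real.pi) x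

theorem hasDerivAt_Z₂ (n : ℕ) (x : ℝ) :
    HasDerivAt (Z₂ n) (-((n : ℝ) * Real.pi * Z₁ n x)) x := by
  rcases eq_or_ne n 0 with rfl | hn
  · have : Z₂ 0 = fun _ => 1 := by ext; simp [Z₂]
    rw [this]; simpa using hasDerivAt_const x (1 : ℝ)
  · have : Z₂ n = fun x => √2 * Real.cos ((n : ℝ) * Real.pi * x) := by ext; simp [Z₂, hn]
    rw [this]
    exact hasDerivAt_sqrt_two_mul_cos ((n : ℝ) * Real.pi) x

theorem contDiff_Z₁ (n : ℕ) : ContDiff ℝ ∞ (Z₁ n) := by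
  unfold Z₁; fun_prop

theorem contDiff_Z₂ (n : ℕ) : ContDiff ℝ ∞ (Z₂ n) := by
  rcases eq_or_ne n 0 with rfl | hn
  · have : Z₂ 0 = fun _ => 1 := by ext; simp [Z₂]
    rw [this]; fun_prop
  · have : Z₂ n = fun x => √2 * Real.cos ((n : ℝ) * Real.pi * x) := by ext; simp [Z₂, hn]
    rw [this]; fun_prop

theorem trigSystem_Z₁ : TrigSystem (fun n => (n : ℝ) * Real.pi) Z₁ Z₂ where
  deriv_fst := hasDerivAt_Z₁
  deriv_snd := hasDerivAt_Z₂
  left := Or.inl fun n => by simp [Z₁]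
  right := Or.inl fun n => by simp [Z₁]
  abs_fst_le n x := abs_sqrt_two_mul_le (Real.abs_sin_le_one _)
  abs_snd_le n x := by
    unfold Z₂
    split_ifs
    · norm_num
    · exact abs_sqrt_two_mul_le (Real.abs_cos_le_one _)
  contDiff_fst := contDiff_Z₁
  contDiff_snd := contDiff_Z₂
  sq_ne n m hnm h := by
    rw [sq_eq_sq₀ (by positivity) (by positivity)] at h
    have := mul_right_cancel₀ Real.pi_ne_zero h
    exact hnm (by exact_mod_cast this)

theorem trigSystem_Z₃ : TrigSystem (fun n => ((n : ℝ) + 1 / 2) * Real.pi) Z₃ Z₄ where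
  deriv_fst n x := hasDerivAt_sqrt_two_mul_sin _ x
  deriv_snd n x := hasDerivAt_sqrt_two_mul_cos _ x
  left := Or.inl fun n => by simp [Z₃]
  right := Or.inr fun n => by
    have : ((n : ℝ) + 1 / 2) * Real.pi = Real.pi / 2 + n * Real.pi := by ring
    simp only [Z₄, mul_one, this, Real.cos_add_nat_mul_pi]; simp
  abs_fst_le n x := abs_sqrt_two_mul_le (Real.abs_sin_le_one _)
  abs_snd_le n x := abs_sqrt_two_mul_le (Real.abs_cos_le_one _)
  contDiff_fst n := by unfold Z₃; fun_prop
  contDiff_snd n := by unfold Z₄; fun_prop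
  sq_ne n m hnm h := by
    rw [sq_eq_sq₀ (by positivity) (by positivity)] at h
    have := mul_right_cancel₀ Real.pi_ne_zero h
    exact hnm (by exact_mod_cast add_right_cancel this)

/-- Reversing the sign of the second family exchanges the roles of sines and cosines. -/
theorem TrigSystem.neg_swap {μ : ℕ → ℝ} {X D : ℕ → ℝ → ℝ} (h : TrigSystem μ X D) :
    TrigSystem μ D (fun n x => -X n x) where
  deriv_fst n x := by simpa using h.deriv_snd n x
  deriv_snd n x := (h.deriv_fst n x).neg.congr_deriv (by ring)
  left := h.left.symm.imp_right fun h n => by simp [h n]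
  right := h.right.symm.imp_right fun h n => by simp [h n]
  abs_fst_le := h.abs_snd_le
  abs_snd_le n x := by simpa using h.abs_fst_le n x
  contDiff_fst := h.contDiff_snd
  contDiff_snd n := (h.contDiff_fst n).neg
  sq_ne := h.sq_ne

theorem sqrt_two_sin_sq_add_cos_sq (t : ℝ) :
    (√2 * Real.sin t) ^ 2 + (√2 * Real.cos t) ^ 2 = 2 := by
  rw [mul_pow, mul_pow, Real.sq_sqrt (by norm_num), ← mul_add, Real.sin_sq_add_cos_sq, mul_one]

theorem isCosineModule_Z₁ : IsCosineModule Z₁ where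
  cos_mul n := by
    rcases n with _ | n
    · exact ⟨0, 0, 0, 0, fun x => by simp [Z₁]⟩
    · refine ⟨1 / 2, 1 / 2, n + 2, n, fun x => ?_⟩
      have e1 : ((n + 2 : ℕ) : ℝ) * Real.pi * x = ((n + 1 : ℕ) : ℝ) * Real.pi * x + Real.pi * x := by
        push_cast; ring
      have e2 : (n : ℝ) * Real.pi * x = ((n + 1 : ℕ) : ℝ) * Real.pi * x - Real.pi * x := by
        push_cast; ring
      simp only [Z₁]
      rw [e1, e2, Real.sin_add, Real.sin_sub]
      ring
  exists_ne_zero := ⟨1, fun x hx => by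
    have : 0 < Real.sin (Real.pi * x) := Real.sin_pos_of_pos_of_lt_pi
      (mul_pos Real.pi_pos hx.1) (by nlinarith [Real.pi_pos, hx.2])
    simp [Z₁, this.ne']⟩
  normalized n := by
    rcases eq_or_ne n 0 with rfl | hn
    · left; ext; simp [Z₁]
    · refine Or.inr (trigSystem_Z₁.integral_sq_eq_one (by positivity) fun x => ?_)
      simp only [Z₁, Z₂, hn, if_false]
      exact sqrt_two_sin_sq_add_cos_sq _

theorem isCosineModule_Z₂ : IsCosineModule Z₂ where
  cos_mul n := by
    have h2 : (√2) ^ 2 = 2 := Real.sq_sqrt (by norm_num)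
    rcases n with _ | _ | n
    -- The constant is normalized to 1 and the other cosines to `√2`, so the products that involve
    -- index 0 carry the factor `√2/2`.
    · refine ⟨√2 / 2, 0, 1, 0, fun x => ?_⟩
      simp only [Z₂]
      simp
      linear_combination (-1 / 2 * Real.cos (Real.pi * x)) * h2
    · refine ⟨1 / 2, √2 / 2, 2, 0, fun x => ?_⟩
      have e1 : (2 : ℝ) * Real.pi * x = 2 * (Real.pi * x) := by ring
      simp only [Z₂]
      simp
      rw [e1, Real.cos_two_mul]
      ring
    · refine ⟨1 / 2, 1 / 2, n + 3, n + 1, fun x => ?_⟩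
      have e1 : ((n + 3 : ℕ) : ℝ) * Real.pi * x
          = ((n + 1 + 1 : ℕ) : ℝ) * Real.pi * x + Real.pi * x := by
        push_cast; ring
      have e2 : ((n + 1 : ℕ) : ℝ) * Real.pi * x
          = ((n + 1 + 1 : ℕ) : ℝ) * Real.pi * x - Real.pi * x := by
        push_cast; ring
      simp only [Z₂, if_neg (Nat.succ_ne_zero _)]
      rw [e1, e2, Real.cos_add, Real.cos_sub]
      ring
  exists_ne_zero := ⟨0, fun x _ => by simp [Z₂]⟩
  normalized n := by
    rcases eq_or_ne n 0 with rfl | hn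
    · right; simp [Z₂]
    · refine Or.inr (trigSystem_Z₁.neg_swap.integral_sq_eq_one (by positivity) fun x => ?_)
      simp only [Z₁, Z₂, hn, if_false]
      rw [add_comm, neg_sq]
      exact sqrt_two_sin_sq_add_cos_sq _

theorem isCosineModule_Z₃ : IsCosineModule Z₃ where
  cos_mul n := by
    rcases n with _ | n
    -- The product formula asks for index `-1`, of frequency `-π/2`; since sine is odd, this is
    -- minus the member of index 0.
    · refine ⟨1 / 2, -1 / 2, 1, 0, fun x => ?_⟩
      have e1 : (((1 : ℕ) : ℝ) + 1 / 2) * Real.pi * x = Real.pi * x / 2 + Real.pi * x := by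
        push_cast; ring
      have e2 : (((0 : ℕ) : ℝ) + 1 / 2) * Real.pi * x = Real.pi * x / 2 := by
        push_cast; ring
      have e3 : Real.sin (Real.pi * x) = 2 * Real.sin (Real.pi * x / 2) * Real.cos (Real.pi * x / 2) := by
        rw [← Real.sin_two_mul]; congr 1; ring
      have e4 : Real.cos (Real.pi * x) = 2 * Real.cos (Real.pi * x / 2) ^ 2 - 1 := by
        rw [← Real.cos_two_mul]; congr 1; ring
      simp only [Z₃]
      rw [e1, e2, Real.sin_add, e3, e4]
      ring
    · refine ⟨1 / 2, 1 / 2, n + 2, n, fun x => ?_⟩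
      have e1 : (((n + 2 : ℕ) : ℝ) + 1 / 2) * Real.pi * x
          = (((n + 1 : ℕ) : ℝ) + 1 / 2) * Real.pi * x + Real.pi * x := by
        push_cast; ring
      have e2 : ((n : ℝ) + 1 / 2) * Real.pi * x
          = (((n + 1 : ℕ) : ℝ) + 1 / 2) * Real.pi * x - Real.pi * x := by
        push_cast; ring
      simp only [Z₃]
      rw [e1, e2, Real.sin_add, Real.sin_sub]
      ring
  exists_ne_zero := ⟨0, fun x hx => by
    have : 0 < Real.sin (((0 : ℕ) + 1 / 2 : ℝ) * Real.pi * x) := Real.sin_pos_of_pos_of_lt_pi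
      (by have := hx.1; positivity) (by push_cast; nlinarith [Real.pi_pos, hx.2])
    exact (mul_pos (by positivity) this).ne'⟩
  normalized n := Or.inr <| trigSystem_Z₃.integral_sq_eq_one (by positivity) fun x =>
    sqrt_two_sin_sq_add_cos_sq _

theorem isCosineModule_Z₄ : IsCosineModule Z₄ where
  cos_mul n := by
    rcases n with _ | n
    · refine ⟨1 / 2, 1 / 2, 1, 0, fun x => ?_⟩
      have e1 : (((1 : ℕ) : ℝ) + 1 / 2) * Real.pi * x = Real.pi * x / 2 + Real.pi * x := by
        push_cast; ring
      have e2 : (((0 : ℕ) : ℝ) + 1 / 2) * Real.pi * x = Real.pi * x / 2 := by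
        push_cast; ring
      have e3 : Real.sin (Real.pi * x) = 2 * Real.sin (Real.pi * x / 2) * Real.cos (Real.pi * x / 2) := by
        rw [← Real.sin_two_mul]; congr 1; ring
      have e4 : Real.cos (Real.pi * x) = 2 * Real.cos (Real.pi * x / 2) ^ 2 - 1 := by
        rw [← Real.cos_two_mul]; congr 1; ring
      simp only [Z₄]
      rw [e1, e2, Real.cos_add, e3, e4]
      linear_combination
        (√2 * Real.cos (Real.pi * x / 2)) * Real.sin_sq_add_cos_sq (Real.pi * x / 2)
    · refine ⟨1 / 2, 1 / 2, n + 2, n, fun x => ?_⟩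
      have e1 : (((n + 2 : ℕ) : ℝ) + 1 / 2) * Real.pi * x
          = (((n + 1 : ℕ) : ℝ) + 1 / 2) * Real.pi * x + Real.pi * x := by
        push_cast; ring
      have e2 : ((n : ℝ) + 1 / 2) * Real.pi * x
          = (((n + 1 : ℕ) : ℝ) + 1 / 2) * Real.pi * x - Real.pi * x := by
        push_cast; ring
      simp only [Z₄]
      rw [e1, e2, Real.cos_add, Real.cos_sub]
      ring
  exists_ne_zero := ⟨0, fun x hx => by
    have : 0 < Real.cos (((0 : ℕ) + 1 / 2 : ℝ) * Real.pi * x) := Real.cos_pos_of_mem_Ioo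
      ⟨by push_cast; nlinarith [Real.pi_pos, hx.1, mul_pos Real.pi_pos hx.1],
        by push_cast; nlinarith [Real.pi_pos, hx.2]⟩
    exact (mul_pos (by positivity) this).ne'⟩
  normalized n := Or.inr <| trigSystem_Z₃.neg_swap.integral_sq_eq_one (by positivity) fun x => by
    rw [add_comm, neg_sq]
    exact sqrt_two_sin_sq_add_cos_sq _

theorem HelmholtzLifting.IsEigenbasis.exists_trigSystem {μ : ℕ → ℝ} {X : ℕ → ℝ → ℝ} (h : IsEigenbasis μ X) :
    IsCosineModule X ∧ (∃ D, TrigSystem μ X D) := by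
  rcases h with ⟨hμ, rfl | rfl⟩ | ⟨hμ, rfl | rfl⟩ <;> rw [funext hμ]
  · exact ⟨isCosineModule_Z₁, _, trigSystem_Z₁⟩
  · exact ⟨isCosineModule_Z₂, _, trigSystem_Z₁.neg_swap⟩
  · exact ⟨isCosineModule_Z₃, _, trigSystem_Z₃⟩
  · exact ⟨isCosineModule_Z₄, _, trigSystem_Z₃.neg_swap⟩

theorem HelmholtzLifting.IsEigenbasis.nat_mul_pi_le {μ : ℕ → ℝ} {X : ℕ → ℝ → ℝ} (h : IsEigenbasis μ X) (n : ℕ) :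
    (n : ℝ) * Real.pi ≤ μ n := by
  rcases h with ⟨hμ, -⟩ | ⟨hμ, -⟩ <;> rw [hμ]
  nlinarith [Real.pi_pos]

/-! ### Completeness -/

theorem integrableOn_mul_of_memLp {g : ℝ → ℂ} (hg : MemLp g 2 (volume.restrict (Ioo (0 : ℝ) 1)))
    {f : ℝ → ℝ} (hf : Continuous f) {C : ℝ} (hC : ∀ x, |f x| ≤ C) :
    IntegrableOn (fun x => g x * (f x : ℂ)) (Ioo 0 1) := by
  have hg1 : Integrable g (volume.restrict (Ioo (0 : ℝ) 1)) := hg.integrable (by norm_num)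
  refine hg1.mul_bdd (c := C) (by fun_prop) (ae_of_all _ fun x => ?_)
  simpa using hC x

/-- Multiplication by `cos(πx)` maps the span of the `Xₙ` into itself, so orthogonality to the span
survives every power of the cosine. -/
theorem IsCosineModule.integral_mul_pow_eq_zero {X : ℕ → ℝ → ℝ} (hX : IsCosineModule X)
    (hXc : ∀ n, Continuous (X n)) {C : ℝ} (hXb : ∀ n x, |X n x| ≤ C) {g : ℝ → ℂ}
    (hg : MemLp g 2 (volume.restrict (Ioo (0 : ℝ) 1)))
    (h0 : ∀ n, coeff X g n = 0) (j : ℕ) :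
    ∀ n, ∫ x in Ioo (0 : ℝ) 1, g x * ((X n x * Real.cos (Real.pi * x) ^ j : ℝ) : ℂ) = 0 := by
  induction j with
  | zero => intro n; simpa [coeff] using h0 n
  | succ j ih =>
    intro n
    obtain ⟨a, b, m, l, h⟩ := hX.cos_mul n
    have e : ∀ x, g x * ((X n x * Real.cos (Real.pi * x) ^ (j + 1) : ℝ) : ℂ)
        = a * (g x * ((X m x * Real.cos (Real.pi * x) ^ j : ℝ) : ℂ))
          + b * (g x * ((X l x * Real.cos (Real.pi * x) ^ j : ℝ) : ℂ)) := by
      intro x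
      have : X n x * Real.cos (Real.pi * x) ^ (j + 1)
          = (a * X m x + b * X l x) * Real.cos (Real.pi * x) ^ j := by
        rw [← h, pow_succ]; ring
      rw [this]
      push_cast
      ring
    have hi : ∀ m, IntegrableOn (fun x => g x * ((X m x * Real.cos (Real.pi * x) ^ j : ℝ) : ℂ))
        (Ioo 0 1) := by
      intro m
      refine integrableOn_mul_of_memLp hg (by have := hXc m; fun_prop) (C := C) fun x => ?_
      rw [abs_mul, abs_pow]
      have h1 := pow_le_one₀ (n := j) (abs_nonneg _) (Real.abs_cos_le_one (Real.pi * x))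
      have h2 := hXb m x
      nlinarith [abs_nonneg (X m x), pow_nonneg (abs_nonneg (Real.cos (Real.pi * x))) j]
    simp_rw [e]
    rw [integral_add ((hi m).const_mul _) ((hi l).const_mul _), integral_const_mul,
      integral_const_mul, ih, ih]
    simp

/-- An `L²` function all of whose coefficients vanish is zero. -/
theorem IsCosineModule.ae_eq_zero {X : ℕ → ℝ → ℝ} (hX : IsCosineModule X)
    (hXc : ∀ n, Continuous (X n)) {C : ℝ} (hXb : ∀ n x, |X n x| ≤ C) {g : ℝ → ℂ}
    (hg : MemLp g 2 (volume.restrict (Ioo (0 : ℝ) 1)))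
    (h0 : ∀ n, coeff X g n = 0) : ∀ᵐ x ∂volume.restrict (Ioo (0 : ℝ) 1), g x = 0 := by
  obtain ⟨n, hn⟩ := hX.exists_ne_zero
  have hw : IntegrableOn (fun x => g x * (X n x : ℂ)) (Ioo 0 1) :=
    integrableOn_mul_of_memLp hg (hXc n) (hXb n)
  -- With one nowhere vanishing `Xₙ` fixed, `g Xₙ` is orthogonal to all polynomials in `cos(πx)`.
  -- These are dense in the continuous functions on `[0,1]`, so `g Xₙ = 0` a.e.
  have hpoly : ∀ p : Polynomial ℝ, ∫ x in Ioo (0 : ℝ) 1,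
      g x * ((X n x * p.eval (Real.cos (Real.pi * x)) : ℝ) : ℂ) = 0 := by
    intro p
    have e : ∀ x, g x * ((X n x * p.eval (Real.cos (Real.pi * x)) : ℝ) : ℂ)
        = ∑ j ∈ Finset.range (p.natDegree + 1),
          (p.coeff j : ℂ) * (g x * ((X n x * Real.cos (Real.pi * x) ^ j : ℝ) : ℂ)) := by
      intro x
      rw [Polynomial.eval_eq_sum_range]
      push_cast
      rw [Finset.mul_sum, Finset.mul_sum]
      exact Finset.sum_congr rfl fun j _ => by ring
    simp_rw [e]
    rw [integral_finsetSum]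
    · refine Finset.sum_eq_zero fun j _ => ?_
      rw [integral_const_mul, hX.integral_mul_pow_eq_zero hXc hXb hg h0 j n, mul_zero]
    · intro j _
      refine (integrableOn_mul_of_memLp hg (by have := hXc n; fun_prop) (C := C) fun x => ?_).const_mul _
      rw [abs_mul, abs_pow]
      have h1 := pow_le_one₀ (n := j) (abs_nonneg _) (Real.abs_cos_le_one (Real.pi * x))
      have h2 := hXb n x
      nlinarith [abs_nonneg (X n x), pow_nonneg (abs_nonneg (Real.cos (Real.pi * x))) j]
  have key : ∀ᵐ x, x ∈ Ioo (0 : ℝ) 1 → g x * (X n x : ℂ) = 0 := by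
    refine isOpen_Ioo.ae_eq_zero_of_integral_contDiff_smul_eq_zero hw.locallyIntegrableOn
      fun f hf hfc hfs => ?_
    rw [← setIntegral_eq_integral_of_forall_compl_eq_zero (s := Ioo 0 1) fun x hx => by
      rw [image_eq_zero_of_notMem_tsupport fun h => hx (hfs h), zero_smul]]
    obtain ⟨B, hB⟩ := hfc.exists_bound_of_continuous hf.continuous
    have hif : IntegrableOn (fun x => f x • (g x * (X n x : ℂ))) (Ioo 0 1) := by
      refine hw.bdd_smul B (hf.continuous.aestronglyMeasurable) (ae_of_all _ hB)
    set G : ℝ := ∫ x in Ioo (0 : ℝ) 1, ‖g x * (X n x : ℂ)‖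
    have hG : 0 ≤ G := integral_nonneg fun _ => norm_nonneg _
    rw [← norm_le_zero_iff]
    refine le_of_forall_pos_le_add fun ε hε => ?_
    -- The cosine `x ↦ cos(πx)` is a homeomorphism of `[0,1]` onto `[-1,1]`. Weierstrass is applied
    -- to `f` in the variable `z = cos(πx)`; the `+ 1` in the tolerance guards against `G = 0`.
    obtain ⟨p, hp⟩ := exists_polynomial_near_of_continuousOn (-1) 1
      (fun z => f (Real.arccos z / Real.pi))
      (hf.continuous.comp (Real.continuous_arccos.div_const _)).continuousOn (ε / (G + 1))
      (by positivity)
    have hp' : ∀ x ∈ Ioo (0 : ℝ) 1, |p.eval (Real.cos (Real.pi * x)) - f x| < ε / (G + 1) := by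
      intro x hx
      have := hp (Real.cos (Real.pi * x)) ⟨Real.neg_one_le_cos _, Real.cos_le_one _⟩
      rwa [Real.arccos_cos (by have := hx.1; positivity) (by nlinarith [Real.pi_pos, hx.2]),
        mul_div_cancel_left₀ _ Real.pi_ne_zero] at this
    have hip : IntegrableOn
        (fun x => g x * ((X n x * p.eval (Real.cos (Real.pi * x)) : ℝ) : ℂ)) (Ioo 0 1) := by
      obtain ⟨B', hB'⟩ := (isCompact_Icc (a := (-1 : ℝ)) (b := 1)).exists_bound_of_continuousOn
        p.continuous.continuousOn
      refine integrableOn_mul_of_memLp hg (by have := hXc n; fun_prop) (C := C * B') fun x => ?_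
      rw [abs_mul]
      have h1 := hB' (Real.cos (Real.pi * x)) ⟨Real.neg_one_le_cos _, Real.cos_le_one _⟩
      exact mul_le_mul (hXb n x) h1 (abs_nonneg _) ((abs_nonneg _).trans (hXb n x))
    have : ∫ x in Ioo (0 : ℝ) 1, f x • (g x * (X n x : ℂ))
        = ∫ x in Ioo (0 : ℝ) 1, (f x • (g x * (X n x : ℂ))
          - g x * ((X n x * p.eval (Real.cos (Real.pi * x)) : ℝ) : ℂ)) := by
      rw [integral_sub hif hip, hpoly p, sub_zero]
    rw [this]
    calc ‖∫ x in Ioo (0 : ℝ) 1, (f x • (g x * (X n x : ℂ))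
          - g x * ((X n x * p.eval (Real.cos (Real.pi * x)) : ℝ) : ℂ))‖
        ≤ ∫ x in Ioo (0 : ℝ) 1, ε / (G + 1) * ‖g x * (X n x : ℂ)‖ := by
          refine norm_integral_le_of_norm_le (hw.norm.const_mul _) ?_
          filter_upwards [ae_restrict_mem measurableSet_Ioo] with x hx
          have e : f x • (g x * (X n x : ℂ))
              - g x * ((X n x * p.eval (Real.cos (Real.pi * x)) : ℝ) : ℂ)
              = ((f x - p.eval (Real.cos (Real.pi * x)) : ℝ) : ℂ) * (g x * (X n x : ℂ)) := by
            rw [Complex.real_smul]; push_cast; ring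
          rw [e, norm_mul, Complex.norm_real, Real.norm_eq_abs, abs_sub_comm]
          exact mul_le_mul_of_nonneg_right (hp' x hx).le (norm_nonneg _)
      _ = ε / (G + 1) * G := integral_const_mul _ _
      _ ≤ 0 + ε := by
          rw [zero_add, div_mul_eq_mul_div, div_le_iff₀ (by positivity)]
          nlinarith
  rw [ae_restrict_iff' measurableSet_Ioo]
  filter_upwards [key] with x hx hxI
  have := hx hxI
  rw [mul_eq_zero] at this
  exact this.resolve_right (by exact_mod_cast hn x hxI)

/-! ### Solvability and uniqueness of the profile problem -/

/-- A fundamental system of `u'' = c u`: `C(0) = 1`, `S(0) = 0`, `C' = c S`, `S' = C`. -/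
structure IsFundamental (c : ℝ) (C S : ℝ → ℂ) : Prop where
  deriv_C : ∀ y, HasDerivAt C (c * S y) y
  deriv_S : ∀ y, HasDerivAt S (C y) y
  C_zero : C 0 = 1
  S_zero : S 0 = 0
  contDiff_C : ContDiff ℝ ∞ C
  contDiff_S : ContDiff ℝ ∞ S

/-- A complex square root `z` of `c` treats the oscillating case `c < 0` and the exponential case `c
> 0` together. -/
theorem isFundamental_sinh_cosh {c : ℝ} {z : ℂ} (hz : z ^ 2 = c) (hz0 : z ≠ 0) :
    IsFundamental c (fun y => Complex.cosh (z * y)) (fun y => Complex.sinh (z * y) / z) where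
  deriv_C y := by
    have h := ((hasDerivAt_id (y : ℂ)).const_mul z).ccosh.comp_ofReal
    refine h.congr_deriv ?_
    rw [← hz]
    simp
    field_simp
  deriv_S y := by
    have h := ((hasDerivAt_id (y : ℂ)).const_mul z).csinh.comp_ofReal.div_const z
    refine h.congr_deriv ?_
    simp
    field_simp
  C_zero := by simp
  S_zero := by simp
  contDiff_C := by
    have : ContDiff ℝ ∞ fun y : ℝ => z * (y : ℂ) := contDiff_const.mul Complex.ofRealCLM.contDiff
    exact (Complex.contDiff_cosh.restrict_scalars ℝ).comp this
  contDiff_S := by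
    have : ContDiff ℝ ∞ fun y : ℝ => z * (y : ℂ) := contDiff_const.mul Complex.ofRealCLM.contDiff
    exact ((Complex.contDiff_sinh.restrict_scalars ℝ).comp this).div_const z

theorem isFundamental_zero : IsFundamental 0 (fun _ => 1) (fun y => (y : ℂ)) where
  deriv_C y := by simpa using hasDerivAt_const y (1 : ℂ)
  deriv_S y := Complex.ofRealCLM.hasDerivAt (x := y)
  C_zero := rfl
  S_zero := by simp
  contDiff_C := contDiff_const
  contDiff_S := Complex.ofRealCLM.contDiff

/-- A classical solution of `Y'' = c Y` on the whole line with the boundary conditions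
`B₁ Y(0) = 1`, `B₃ Y(1) = 0`; the derivative is `Y'`. -/
structure IsSmoothProfile (c : ℝ) (B₁ B₃ : HorizontalBC) (Y Y' : ℝ → ℂ) : Prop where
  deriv : ∀ y, HasDerivAt Y (Y' y) y
  deriv' : ∀ y, HasDerivAt Y' (c * Y y) y
  contDiff : ContDiff ℝ ∞ Y
  contDiff' : ContDiff ℝ ∞ Y'
  bc_zero : B₁.eval (Y 0) (-(Y' 0)) = 1
  bc_one : B₃.eval (Y 1) (Y' 1) = 0

theorem IsSmoothProfile.isProfile {k μ : ℝ} {B₁ B₃ : HorizontalBC} {Y Y' : ℝ → ℂ}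
    (h : IsSmoothProfile (μ ^ 2 - k ^ 2) B₁ B₃ Y Y') : IsProfile k μ B₁ B₃ Y :=
  ⟨Y', h.contDiff'.continuous.continuousOn, fun y _ => (h.deriv y).hasDerivWithinAt,
    fun y _ => (h.deriv' y).congr_deriv (by push_cast; ring), h.bc_zero, h.bc_one⟩

/-- The solution satisfying the homogeneous condition `B₃` at `1`, and its derivative. -/
noncomputable def terminalSol (B₃ : HorizontalBC) (C S : ℝ → ℂ) (y : ℝ) : ℂ :=
  match B₃ with
  | .dirichlet => S (1 - y)
  | .neumann => C (1 - y)

noncomputable def terminalSolDeriv (c : ℝ) (B₃ : HorizontalBC) (C S : ℝ → ℂ) (y : ℝ) : ℂ :=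
  match B₃ with
  | .dirichlet => -C (1 - y)
  | .neumann => -(c * S (1 - y))

theorem hasDerivAt_comp_one_sub {f : ℝ → ℂ} {f' : ℂ} {y : ℝ} (h : HasDerivAt f f' (1 - y)) :
    HasDerivAt (fun y => f (1 - y)) (-f') y := by
  have h2 : HasDerivAt (fun y : ℝ => 1 - y) (-1) y := by
    simpa using (hasDerivAt_id y).const_sub 1
  have := h.scomp y h2
  exact this.congr_deriv (by simp)

/-- The value of `B₁` at `0` on the solution with `B₃ = 0` at `1`. -/
noncomputable def bcDet (c : ℝ) (B₁ B₃ : HorizontalBC) (C S : ℝ → ℂ) : ℂ :=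
  B₁.eval (terminalSol B₃ C S 0) (-(terminalSolDeriv c B₃ C S 0))

theorem IsFundamental.isSmoothProfile {c : ℝ} {C S : ℝ → ℂ} (h : IsFundamental c C S)
    {B₁ B₃ : HorizontalBC} (hd : bcDet c B₁ B₃ C S ≠ 0) :
    IsSmoothProfile c B₁ B₃ (fun y => terminalSol B₃ C S y / bcDet c B₁ B₃ C S)
      (fun y => terminalSolDeriv c B₃ C S y / bcDet c B₁ B₃ C S) where
  deriv y := by
    refine HasDerivAt.div_const ?_ _
    cases B₃
    · exact hasDerivAt_comp_one_sub (h.deriv_S _)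
    · exact hasDerivAt_comp_one_sub (h.deriv_C _)
  deriv' y := by
    rw [← mul_div_assoc]
    refine HasDerivAt.div_const ?_ _
    cases B₃
    · exact (hasDerivAt_comp_one_sub (h.deriv_C _)).neg.congr_deriv (by simp [terminalSol])
    · exact ((hasDerivAt_comp_one_sub (h.deriv_S _)).const_mul (c : ℂ)).neg.congr_deriv
        (by simp [terminalSol])
  contDiff := by
    have h1 : ContDiff ℝ ∞ fun y : ℝ => 1 - y := contDiff_const.sub contDiff_id
    cases B₃
    · exact (h.contDiff_S.comp h1).div_const _
    · exact (h.contDiff_C.comp h1).div_const _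
  contDiff' := by
    have h1 : ContDiff ℝ ∞ fun y : ℝ => 1 - y := contDiff_const.sub contDiff_id
    cases B₃
    · exact (h.contDiff_C.comp h1).neg.div_const _
    · exact (contDiff_const.mul (h.contDiff_S.comp h1)).neg.div_const _
  bc_zero := by
    have : B₁.eval (terminalSol B₃ C S 0 / bcDet c B₁ B₃ C S)
        (-(terminalSolDeriv c B₃ C S 0 / bcDet c B₁ B₃ C S))
        = bcDet c B₁ B₃ C S / bcDet c B₁ B₃ C S := by
      conv_rhs => enter [1]; rw [bcDet]
      cases B₁ <;> simp [HorizontalBC.eval, neg_div]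
    rw [this, div_self hd]
  bc_one := by
    cases B₃ <;> simp [HorizontalBC.eval, terminalSol, terminalSolDeriv, h.S_zero]

/-- Continuity up to the end points and a derivative in the interior are all that `IsProfile` gives
for `Y'`. -/
theorem eq_of_hasDerivAt_zero_Icc {f : ℝ → ℂ} (hc : ContinuousOn f (Icc 0 1))
    (hd : ∀ y ∈ Ioo (0 : ℝ) 1, HasDerivAt f 0 y) : ∀ y ∈ Icc (0 : ℝ) 1, f y = f 1 := by
  intro y hy
  rcases eq_or_lt_of_le hy.2 with rfl | hlt
  · rfl
  have hint := intervalIntegral.integral_eq_sub_of_hasDerivAt_of_le (f := f) (f' := fun _ => 0)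
    hy.2 (hc.mono (Icc_subset_Icc_left hy.1)) (fun x hx => hd x ⟨hy.1.trans_lt hx.1, hx.2⟩)
    (by simp)
  simp only [intervalIntegral.integral_zero] at hint
  exact (sub_eq_zero.1 hint.symm).symm

/-- Every profile is a multiple of the terminal solution, hence unique. -/
theorem IsFundamental.eqOn_of_isProfile {k μ : ℝ} {B₁ B₃ : HorizontalBC} {C S W : ℝ → ℂ}
    (h : IsFundamental (μ ^ 2 - k ^ 2) C S)
    (hW : IsProfile k μ B₁ B₃ W) : bcDet (μ ^ 2 - k ^ 2) B₁ B₃ C S ≠ 0 ∧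
    EqOn W (fun y => terminalSol B₃ C S y / bcDet (μ ^ 2 - k ^ 2) B₁ B₃ C S) (Icc 0 1) := by
  obtain ⟨W', hW'c, hd, hd', h0, h1⟩ := hW
  set c := μ ^ 2 - k ^ 2 with hc
  have hWc : ContinuousOn W (Icc 0 1) := fun y hy => (hd y hy).continuousWithinAt
  have hCc : Continuous fun y : ℝ => C (1 - y) :=
    h.contDiff_C.continuous.comp (continuous_const.sub continuous_id)
  have hSc : Continuous fun y : ℝ => S (1 - y) :=
    h.contDiff_S.continuous.comp (continuous_const.sub continuous_id)
  have hdI : ∀ y ∈ Ioo (0 : ℝ) 1, HasDerivAt W (W' y) y := fun y hy =>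
    (hd y (Ioo_subset_Icc_self hy)).hasDerivAt (Icc_mem_nhds hy.1 hy.2)
  have hdC := fun y => hasDerivAt_comp_one_sub (h.deriv_C (1 - y))
  have hdS := fun y => hasDerivAt_comp_one_sub (h.deriv_S (1 - y))
  -- Two first integrals: the Wronskians of `W` with `C(1 - y)` and with `S(1 - y)`. They equal
  -- `W'(1)` and `W(1)`.
  have cC := eq_of_hasDerivAt_zero_Icc (f := fun y => W y * (c * S (1 - y)) + W' y * C (1 - y))
    ((hWc.mul (continuous_const.mul hSc).continuousOn).add (hW'c.mul hCc.continuousOn))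
    fun y hy => by
      refine (((hdI y hy).mul ((hdS y).const_mul (c : ℂ))).add ((hd' y hy).mul (hdC y))).congr_deriv ?_
      rw [hc]; push_cast; ring
  have cS := eq_of_hasDerivAt_zero_Icc (f := fun y => W y * C (1 - y) + W' y * S (1 - y))
    ((hWc.mul hCc.continuousOn).add (hW'c.mul hSc.continuousOn))
    fun y hy => by
      refine (((hdI y hy).mul (hdC y)).add ((hd' y hy).mul (hdS y))).congr_deriv ?_
      rw [hc]; push_cast; ring
  -- The Wronskian of the fundamental system, `C² - c S² = 1`.
  have cD := eq_of_hasDerivAt_zero_Icc (f := fun y => C (1 - y) * C (1 - y) - c * S (1 - y) * S (1 - y))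
    ((hCc.mul hCc).sub ((continuous_const.mul hSc).mul hSc)).continuousOn
    fun y hy => by
      refine (((hdC y).mul (hdC y)).sub (((hdS y).const_mul (c : ℂ)).mul (hdS y))).congr_deriv ?_
      ring
  simp only [sub_self, h.C_zero, h.S_zero, mul_zero, mul_one, zero_add, add_zero, sub_zero] at cC cS cD
  -- Cramer's rule for the two first integrals, whose determinant is the Wronskian 1.
  have key : ∀ y ∈ Icc (0 : ℝ) 1, W y = W 1 * C (1 - y) - W' 1 * S (1 - y) := by
    intro y hy
    linear_combination C (1 - y) * cS y hy - S (1 - y) * cC y hy - W y * cD y hy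
  have key' : ∀ y ∈ Icc (0 : ℝ) 1, W' y = W' 1 * C (1 - y) - W 1 * (c * S (1 - y)) := by
    intro y hy
    linear_combination C (1 - y) * cC y hy - c * S (1 - y) * cS y hy - W' y * cD y hy
  have z0 : (0 : ℝ) ∈ Icc (0 : ℝ) 1 := ⟨le_rfl, zero_le_one⟩
  obtain ⟨a, ha, ha'⟩ : ∃ a : ℂ, (∀ y ∈ Icc (0 : ℝ) 1, W y = a * terminalSol B₃ C S y) ∧
      ∀ y ∈ Icc (0 : ℝ) 1, W' y = a * terminalSolDeriv c B₃ C S y := by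
    cases B₃
    · replace h1 : W 1 = 0 := h1
      exact ⟨-W' 1, fun y hy => by rw [key y hy, h1, terminalSol]; ring,
        fun y hy => by rw [key' y hy, h1, terminalSolDeriv]; ring⟩
    · replace h1 : W' 1 = 0 := h1
      exact ⟨W 1, fun y hy => by rw [key y hy, h1, terminalSol]; ring,
        fun y hy => by rw [key' y hy, h1, terminalSolDeriv]; ring⟩
  -- The condition `B₁ W(0) = 1` fixes the multiple `a`. The existence of one profile thus forces
  -- the determinant of any fundamental system to be nonzero.
  have hdet : a * bcDet c B₁ B₃ C S = 1 := by
    rw [← h0, ha 0 z0, ha' 0 z0, bcDet]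
    cases B₁ <;> simp [HorizontalBC.eval]
  have hne : bcDet c B₁ B₃ C S ≠ 0 := right_ne_zero_of_mul (hdet ▸ one_ne_zero)
  refine ⟨hne, fun y hy => ?_⟩
  simp only
  rw [ha y hy, eq_div_iff hne]
  linear_combination terminalSol B₃ C S y * hdet

/-! ### Non-resonance -/

/-- `k² - μ²` is not an eigenvalue of `-d²/dy²` with the boundary conditions `B₁`, `B₃`. -/
def IsNonresonant (k μ : ℝ) (B₁ B₃ : HorizontalBC) : Prop :=
  (B₁ = B₃ → ∀ m : ℤ, k ^ 2 ≠ μ ^ 2 + ((m : ℝ) * Real.pi) ^ 2) ∧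
  (B₁ ≠ B₃ → ∀ m : ℤ, k ^ 2 ≠ μ ^ 2 + (((m : ℝ) + 1 / 2) * Real.pi) ^ 2)

/-- For `0 ≤ δ ≤ 1/2` the integer nearest to `m + δ` is at distance `δ`. -/
theorem distLattice_eq_of_abs_le {k δ : ℝ} (hδ : 0 ≤ δ) (hδ' : δ ≤ 1 / 2) (m : ℤ)
    (h : k ^ 2 = (m + δ) * Real.pi ^ 2) : distLattice k = δ * Real.pi ^ 2 := by
  have hb : BddBelow (range fun n : ℤ => |k ^ 2 - (n : ℝ) * Real.pi ^ 2|) :=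
    ⟨0, by rintro _ ⟨n, rfl⟩; exact abs_nonneg _⟩
  apply le_antisymm
  · refine (ciInf_le hb m).trans_eq ?_
    rw [h, ← sub_mul, add_sub_cancel_left, abs_of_nonneg (by positivity)]
  · refine le_ciInf fun n => ?_
    rw [h, ← sub_mul, abs_mul, abs_of_nonneg (sq_nonneg Real.pi)]
    refine mul_le_mul_of_nonneg_right ?_ (sq_nonneg _)
    rcases le_or_gt n m with hnm | hnm
    · have : (n : ℝ) ≤ m := by exact_mod_cast hnm
      exact (by linarith : δ ≤ (m : ℝ) + δ - n).trans (le_abs_self _)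
    · have : (m : ℝ) + 1 ≤ n := by exact_mod_cast hnm
      exact (by linarith : δ ≤ -((m : ℝ) + δ - n)).trans (neg_le_abs _)

/-- A resonance would make `distLattice k` equal to `π²/4`, `0`, `π²/4` or `π²/2` in the four cases
of the rule, in this order. Each case excludes its own value: squares of half-integers are integers
plus `1/4`. -/
theorem isNonresonant_liftFreq (k : ℝ) (B₁ B₃ : HorizontalBC) (n : ℕ) :
    IsNonresonant k (liftFreq k B₁ B₃ n) B₁ B₃ := by
  have hpi := sq_pos_of_pos Real.pi_pos
  unfold IsNonresonant liftFreq
  split_ifs with h1 h2 h2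
  all_goals
    simp only [h1, ne_eq, not_true_eq_false, not_false_eq_true, false_imp_iff, true_imp_iff,
      and_true, true_and]
    intro m hm
  · have := distLattice_eq_of_abs_le (k := k) (δ := 1 / 4) (by norm_num) (by norm_num)
      (m ^ 2 + n ^ 2 + n) (by rw [hm]; push_cast; ring)
    rw [this] at h2
    linarith [h2.2]
  · have := distLattice_eq_of_abs_le (k := k) (δ := 0) (by norm_num) (by norm_num)
      (m ^ 2 + n ^ 2) (by rw [hm]; push_cast; ring)
    rw [this] at h2
    exact h2 ⟨by simp, by linarith⟩
  · have := distLattice_eq_of_abs_le (k := k) (δ := 1 / 4) (by norm_num) (by norm_num)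
      (m ^ 2 + m + n ^ 2) (by rw [hm]; push_cast; ring)
    rw [this] at h2
    rcases h2 with h2 | h2
    · linarith [h2.2]
    · linarith [h2.1]
  · have := distLattice_eq_of_abs_le (k := k) (δ := 1 / 2) (by norm_num) (by norm_num)
      (m ^ 2 + m + n ^ 2 + n) (by rw [hm]; push_cast; ring)
    rw [this] at h2
    exact h2 (Or.inr ⟨by linarith, le_rfl⟩)

theorem Complex.sinh_ne_zero {z : ℂ} (h : ∀ m : ℤ, z ^ 2 ≠ -((m : ℂ) * Real.pi) ^ 2) :
    Complex.sinh z ≠ 0 := by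
  intro h0
  have : Complex.sin (z * Complex.I) = 0 := by rw [Complex.sin_mul_I, h0, zero_mul]
  obtain ⟨m, hm⟩ := Complex.sin_eq_zero_iff.1 this
  refine h m ?_
  rw [← hm, mul_pow, Complex.I_sq]; ring

theorem Complex.cosh_ne_zero {z : ℂ} (h : ∀ m : ℤ, z ^ 2 ≠ -(((m : ℂ) + 1 / 2) * Real.pi) ^ 2) :
    Complex.cosh z ≠ 0 := by
  intro h0
  have : Complex.cos (z * Complex.I) = 0 := by rw [Complex.cos_mul_I, h0]
  obtain ⟨m, hm⟩ := Complex.cos_eq_zero_iff.1 this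
  refine h m ?_
  have e : ((m : ℂ) + 1 / 2) * Real.pi = z * Complex.I := by rw [hm]; ring
  rw [e, mul_pow, Complex.I_sq]; ring

theorem IsNonresonant.exists_isFundamental {k μ : ℝ} {B₁ B₃ : HorizontalBC}
    (h : IsNonresonant k μ B₁ B₃) :
    ∃ C S, IsFundamental (μ ^ 2 - k ^ 2) C S ∧ bcDet (μ ^ 2 - k ^ 2) B₁ B₃ C S ≠ 0 := by
  by_cases hc : μ ^ 2 - k ^ 2 = 0
  -- For `c = 0` the solutions are affine. Only the Neumann–Neumann problem degenerates, and it is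
  -- excluded as the resonance `m = 0`.
  · have hne : B₁ = .neumann → B₃ ≠ .neumann := by
      rintro rfl rfl
      exact h.1 rfl 0 (by simp; linarith)
    rw [hc]
    refine ⟨_, _, isFundamental_zero, ?_⟩
    cases B₁ <;> cases B₃ <;>
      simp_all [bcDet, HorizontalBC.eval, terminalSol, terminalSolDeriv]
  · obtain ⟨z, hz⟩ := IsAlgClosed.exists_pow_nat_eq ((μ ^ 2 - k ^ 2 : ℝ) : ℂ) two_pos
    have hz0 : z ≠ 0 := by
      rintro rfl
      apply hc
      exact_mod_cast (by simpa using hz.symm : ((μ ^ 2 - k ^ 2 : ℝ) : ℂ) = 0)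
    refine ⟨_, _, isFundamental_sinh_cosh hz hz0, ?_⟩
    have hs : B₁ = B₃ → Complex.sinh z ≠ 0 := fun hB => by
      refine Complex.sinh_ne_zero fun m hm => h.1 hB m ?_
      rw [hz] at hm
      have : μ ^ 2 - k ^ 2 = -((m : ℝ) * Real.pi) ^ 2 := by exact_mod_cast hm
      linarith
    have hch : B₁ ≠ B₃ → Complex.cosh z ≠ 0 := fun hB => by
      refine Complex.cosh_ne_zero fun m hm => h.2 hB m ?_
      rw [hz] at hm
      have e : ((1 / 2 : ℝ) : ℂ) = 1 / 2 := by norm_num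
      rw [← e] at hm
      have : μ ^ 2 - k ^ 2 = -(((m : ℝ) + 1 / 2) * Real.pi) ^ 2 := by exact_mod_cast hm
      linarith
    have hcc : ((μ ^ 2 - k ^ 2 : ℝ) : ℂ) ≠ 0 := by exact_mod_cast hc
    cases B₁ <;> cases B₃
    · simpa [bcDet, HorizontalBC.eval, terminalSol, hz0] using hs rfl
    · simpa [bcDet, HorizontalBC.eval, terminalSol] using hch (by simp)
    · simpa [bcDet, HorizontalBC.eval, terminalSolDeriv] using hch (by simp)
    · have := hs rfl
      simp only [bcDet, HorizontalBC.eval, terminalSolDeriv, sub_zero, Complex.ofReal_one, mul_one,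
        neg_neg]
      exact mul_ne_zero hcc (div_ne_zero this hz0)

/-! ### Decay -/

/-- The size of the profile: `1` for a Dirichlet and `1/λ` for a Neumann condition at `0`. -/
noncomputable def profileScale (B₁ : HorizontalBC) (l : ℝ) : ℝ :=
  match B₁ with
  | .dirichlet => 1
  | .neumann => l⁻¹

theorem exp_div_four_le_sinh {l : ℝ} (hl : 1 ≤ l) : Real.exp l / 4 ≤ Real.sinh l := by
  rw [Real.sinh_eq]
  have h1 : Real.exp (-l) ≤ 1 := Real.exp_le_one_iff.2 (by linarith)
  have h2 : (2 : ℝ) ≤ Real.exp l := by linarith [Real.add_one_le_exp l]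
  linarith

theorem exp_div_four_le_cosh (l : ℝ) : Real.exp l / 4 ≤ Real.cosh l := by
  rw [Real.cosh_eq]
  linarith [Real.exp_pos l, Real.exp_pos (-l)]

theorem sinh_le_exp {t : ℝ} (_ht : 0 ≤ t) : |Real.sinh t| ≤ Real.exp t := by
  rw [abs_of_nonneg (Real.sinh_nonneg_iff.2 _ht), Real.sinh_eq]
  linarith [Real.exp_pos t, Real.exp_pos (-t)]

theorem cosh_le_exp {t : ℝ} (ht : 0 ≤ t) : |Real.cosh t| ≤ Real.exp t := by
  rw [abs_of_pos (Real.cosh_pos t), Real.cosh_eq]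
  have : Real.exp (-t) ≤ Real.exp t := Real.exp_le_exp.2 (by linarith)
  linarith

/-- Numerators grow at most like `e^{l(1-y)}` and denominators at least like `e^l`, so all four
quotients of `sinh` and `cosh` decay like `e^{-ly}`, uniformly in `l`. -/
theorem norm_div_le_exp {a b l y : ℝ} (ha : |a| ≤ Real.exp (l * (1 - y)))
    (hb : Real.exp l / 4 ≤ b) : ‖(a : ℂ) / b‖ ≤ 4 * Real.exp (-(l * y)) := by
  have hb0 : 0 < b := lt_of_lt_of_le (by positivity) hb
  rw [norm_div, Complex.norm_real, Complex.norm_real, Real.norm_eq_abs, Real.norm_eq_abs,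
    abs_of_pos hb0, div_le_iff₀ hb0]
  refine ha.trans ?_
  have : Real.exp (l * (1 - y)) = 4 * Real.exp (-(l * y)) * (Real.exp l / 4) := by
    rw [show l * (1 - y) = -(l * y) + l by ring, Real.exp_add]; ring
  rw [this]
  exact mul_le_mul_of_nonneg_left hb (by positivity)

/-- For `c = λ² ≥ 1` the profile decays exponentially. -/
theorem exists_isFundamental_decay {c : ℝ} (hc : 1 ≤ c) (B₁ B₃ : HorizontalBC) :
    ∃ C S, IsFundamental c C S ∧ ∀ y ∈ Icc (0 : ℝ) 1,
      ‖terminalSol B₃ C S y / bcDet c B₁ B₃ C S‖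
        ≤ profileScale B₁ √c * (4 * Real.exp (-(√c * y))) ∧
      ‖terminalSolDeriv c B₃ C S y / bcDet c B₁ B₃ C S‖
        ≤ √c * profileScale B₁ √c * (4 * Real.exp (-(√c * y))) := by
  set l := √c with hl
  have hl1 : 1 ≤ l := Real.one_le_sqrt.2 hc
  have hl0 : 0 < l := by linarith
  have hlc : (l : ℂ) ≠ 0 := by exact_mod_cast hl0.ne'
  have hlsq : l ^ 2 = c := Real.sq_sqrt (by linarith)
  have hlsqc : (l : ℂ) ^ 2 = c := by exact_mod_cast hlsq
  refine ⟨_, _, isFundamental_sinh_cosh hlsqc hlc, fun y hy => ?_⟩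
  have hs := sinh_le_exp (t := l * (1 - y)) (mul_nonneg hl0.le (by linarith [hy.2]))
  have hch := cosh_le_exp (t := l * (1 - y)) (mul_nonneg hl0.le (by linarith [hy.2]))
  have hs' := exp_div_four_le_sinh hl1
  have hch' := exp_div_four_le_cosh l
  have ss := norm_div_le_exp hs hs'
  have sc := norm_div_le_exp hs hch'
  have cs := norm_div_le_exp hch hs'
  have cc := norm_div_le_exp hch hch'
  have nl : ‖(l : ℂ)‖ = l := by simp [abs_of_pos hl0]
  have hsn : Complex.sinh l ≠ 0 := by
    rw [← Complex.ofReal_sinh]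
    exact_mod_cast (lt_of_lt_of_le (by positivity) hs').ne'
  have hcn : Complex.cosh l ≠ 0 := by
    rw [← Complex.ofReal_cosh]
    exact_mod_cast (lt_of_lt_of_le (by positivity) hch').ne'
  push_cast at ss sc cs cc
  cases B₁ <;> cases B₃ <;>
    simp only [bcDet, HorizontalBC.eval, terminalSol, terminalSolDeriv, profileScale, ← hlsqc,
      sub_zero, Complex.ofReal_one, mul_one, one_mul, neg_neg, Complex.ofReal_sub]
  · constructor
    · rwa [div_div_div_cancel_right₀ hlc]
    · rw [neg_div, norm_neg, div_div_eq_mul_div, mul_comm, mul_div_assoc, norm_mul, nl]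
      gcongr
  · refine ⟨cc, ?_⟩
    rw [neg_div, norm_neg,
      show (l : ℂ) ^ 2 * (Complex.sinh (l * (1 - y)) / l) / Complex.cosh l
        = l * (Complex.sinh (l * (1 - y)) / Complex.cosh l) by field_simp, norm_mul, nl]
    gcongr
  · constructor
    · rw [div_right_comm, norm_div, nl, div_eq_inv_mul]
      gcongr
    · rw [neg_div, norm_neg, mul_inv_cancel₀ hl0.ne', one_mul]
      exact cc
  · constructor
    · rw [show Complex.cosh (l * (1 - y)) / ((l : ℂ) ^ 2 * (Complex.sinh l / l))
        = (Complex.cosh (l * (1 - y)) / Complex.sinh l) / l by field_simp, norm_div, nl,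
        div_eq_inv_mul]
      gcongr
    · rw [neg_div, norm_neg, mul_inv_cancel₀ hl0.ne', one_mul,
        show (l : ℂ) ^ 2 * (Complex.sinh (l * (1 - y)) / l) / ((l : ℂ) ^ 2 * (Complex.sinh l / l))
        = Complex.sinh (l * (1 - y)) / Complex.sinh l by field_simp]
      exact ss

/-- The boundary value problem has exactly one solution; it is smooth, and decays if
`μ² - k² ≥ 1`. -/
theorem IsNonresonant.exists_isSmoothProfile {k μ : ℝ} {B₁ B₃ : HorizontalBC}
    (h : IsNonresonant k μ B₁ B₃) :
    ∃ Y Y', IsSmoothProfile (μ ^ 2 - k ^ 2) B₁ B₃ Y Y' ∧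
      (∀ W, IsProfile k μ B₁ B₃ W → EqOn W Y (Icc 0 1)) ∧
      (1 ≤ μ ^ 2 - k ^ 2 → ∀ y ∈ Icc (0 : ℝ) 1,
        ‖Y y‖ ≤ profileScale B₁ √(μ ^ 2 - k ^ 2) * (4 * Real.exp (-(√(μ ^ 2 - k ^ 2) * y))) ∧
        ‖Y' y‖ ≤ √(μ ^ 2 - k ^ 2) * profileScale B₁ √(μ ^ 2 - k ^ 2)
          * (4 * Real.exp (-(√(μ ^ 2 - k ^ 2) * y)))) := by
  obtain ⟨C, S, hf, hd⟩ := h.exists_isFundamental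
  by_cases hc : 1 ≤ μ ^ 2 - k ^ 2
  · obtain ⟨C', S', hf', hb⟩ := exists_isFundamental_decay hc B₁ B₃
    -- The real fundamental system used for the decay may differ from the one obtained from
    -- nonresonance; its determinant is nonzero because a profile exists.
    have hd' := (hf'.eqOn_of_isProfile (hf.isSmoothProfile hd).isProfile).1
    exact ⟨_, _, hf'.isSmoothProfile hd', fun W hW => (hf'.eqOn_of_isProfile hW).2, fun _ => hb⟩
  · exact ⟨_, _, hf.isSmoothProfile hd, fun W hW => (hf.eqOn_of_isProfile hW).2,
      fun h1 => absurd h1 hc⟩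

/-- Integrating `16 A² e^{-2ly}` gains the factor `1/l`, that is, half a power of the frequency in
the `L²` norm. -/
theorem integral_norm_sq_le_of_exp_decay {W : ℝ → ℂ} (hW : Continuous W) {A l : ℝ} (hl : 0 < l)
    (h : ∀ y ∈ Icc (0 : ℝ) 1, ‖W y‖ ≤ A * (4 * Real.exp (-(l * y)))) :
    ∫ y in Ioo (0 : ℝ) 1, ‖W y‖ ^ 2 ≤ 8 * A ^ 2 / l := by
  have hd : ∀ y, HasDerivAt (fun y => -(8 * A ^ 2 / l) * Real.exp (-(2 * l * y)))
      (16 * A ^ 2 * Real.exp (-(2 * l * y))) y := by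
    intro y
    have := ((((hasDerivAt_id y).const_mul (2 * l)).neg).exp).const_mul (-(8 * A ^ 2 / l))
    refine this.congr_deriv ?_
    simp
    field_simp
    ring
  have hc : Continuous fun y => 16 * A ^ 2 * Real.exp (-(2 * l * y)) := by fun_prop
  have hi := intervalIntegral.integral_eq_sub_of_hasDerivAt (a := 0) (b := 1) (fun x _ => hd x)
    (hc.intervalIntegrable 0 1)
  rw [setIntegral_Ioo_eq_intervalIntegral]
  calc ∫ y in (0 : ℝ)..1, ‖W y‖ ^ 2
      ≤ ∫ y in (0 : ℝ)..1, 16 * A ^ 2 * Real.exp (-(2 * l * y)) := by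
        refine intervalIntegral.integral_mono_on zero_le_one
          ((hW.norm.pow 2).intervalIntegrable 0 1) (hc.intervalIntegrable 0 1) fun y hy => ?_
        have := pow_le_pow_left₀ (norm_nonneg _) (h y hy) 2
        refine this.trans_eq ?_
        rw [mul_pow, mul_pow, ← Real.exp_nat_mul]
        push_cast
        rw [show (2 : ℝ) * -(l * y) = -(2 * l * y) by ring]
        ring
    _ ≤ 8 * A ^ 2 / l := by
        rw [hi]
        have : 0 ≤ 8 * A ^ 2 / l * Real.exp (-(2 * l * 1)) := by positivity
        simp only [mul_zero, neg_zero, Real.exp_zero]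
        linarith

/-! ### Convergence in `L²` -/

/-- `f m → g` in `L²(μ)`. -/
def TendstoL2 {α : Type*} [MeasurableSpace α] (μ : Measure α) (f : ℕ → α → ℂ) (g : α → ℂ) : Prop :=
  Tendsto (fun m => eLpNorm (fun p => f m p - g p) 2 μ) atTop (𝓝 0)

section L2
variable {α : Type*} [MeasurableSpace α] {μ : Measure α}

theorem norm_sum_sq_of_orthogonal {E ι : Type*} [NormedAddCommGroup E] [InnerProductSpace ℂ E]
    {F : ι → E} (h : ∀ i j, i ≠ j → inner ℂ (F i) (F j) = 0) (s : Finset ι) :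
    ‖∑ i ∈ s, F i‖ ^ 2 = ∑ i ∈ s, ‖F i‖ ^ 2 := by
  classical
  have : (inner ℂ (∑ i ∈ s, F i) (∑ i ∈ s, F i) : ℂ) = ∑ i ∈ s, inner ℂ (F i) (F i) := by
    rw [sum_inner]
    refine Finset.sum_congr rfl fun i hi => ?_
    rw [inner_sum]
    exact Finset.sum_eq_single_of_mem i hi fun j _ hj => h i j hj.symm
  simp only [inner_self_eq_norm_sq_to_K] at this
  exact_mod_cast this

/-- Pythagoras turns the Cauchy criterion for the squared norms into that for the series itself. -/
theorem summable_of_orthogonal {E : Type*} [NormedAddCommGroup E] [InnerProductSpace ℂ E]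
    [CompleteSpace E] {F : ℕ → E} (h : ∀ i j, i ≠ j → inner ℂ (F i) (F j) = 0)
    (hs : Summable fun i => ‖F i‖ ^ 2) : Summable F := by
  rw [summable_iff_vanishing_norm] at hs ⊢
  intro ε hε
  obtain ⟨s, hs⟩ := hs (ε ^ 2) (by positivity)
  refine ⟨s, fun t ht => ?_⟩
  have := hs t ht
  rw [← norm_sum_sq_of_orthogonal h, Real.norm_of_nonneg (sq_nonneg _)] at this
  exact lt_of_pow_lt_pow_left₀ 2 hε.le this

theorem MeasureTheory.MemLp.toLp_sum {ι : Type*} {f : ι → α → ℂ} (hf : ∀ n, MemLp (f n) 2 μ)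
    (s : Finset ι) : (memLp_finsetSum s fun n _ => hf n).toLp (fun x => ∑ n ∈ s, f n x)
      = ∑ n ∈ s, (hf n).toLp (f n) := by
  classical
  induction s using Finset.induction_on with
  | empty => simp; rfl
  | insert a s ha ih =>
    rw [Finset.sum_insert ha, ← ih, ← MemLp.toLp_add]
    congr 1
    ext x
    simp [Finset.sum_insert ha]

/-- A series of pairwise orthogonal functions with summable squared norms converges in `L²`. -/
theorem exists_tendstoL2_of_orthogonal {f : ℕ → α → ℂ} (hf : ∀ n, MemLp (f n) 2 μ)
    (ho : ∀ n m, n ≠ m → ∫ x, f m x * (starRingEnd ℂ) (f n x) ∂μ = 0)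
    (hs : Summable fun n => ∫ x, ‖f n x‖ ^ 2 ∂μ) :
    ∃ g, MemLp g 2 μ ∧ TendstoL2 μ (fun M x => ∑ n ∈ Finset.range M, f n x) g := by
  set F : ℕ → Lp ℂ 2 μ := fun n => (hf n).toLp (f n) with hF
  have hin : ∀ n m, inner ℂ (F n) (F m) = ∫ x, f m x * (starRingEnd ℂ) (f n x) ∂μ := by
    intro n m
    rw [L2.inner_def]
    refine integral_congr_ae ?_
    filter_upwards [(hf n).coeFn_toLp, (hf m).coeFn_toLp] with x h1 h2
    rw [h1, h2, RCLike.inner_apply]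
  have hnorm : ∀ n, ‖F n‖ ^ 2 = ∫ x, ‖f n x‖ ^ 2 ∂μ := by
    intro n
    have h1 := hin n n
    rw [inner_self_eq_norm_sq_to_K] at h1
    have h2 : ∀ x, f n x * (starRingEnd ℂ) (f n x) = ((‖f n x‖ ^ 2 : ℝ) : ℂ) := fun x => by
      rw [Complex.mul_conj, Complex.normSq_eq_norm_sq]
    simp_rw [h2] at h1
    rw [integral_complex_ofReal] at h1
    rw [← Complex.ofReal_inj, ← h1]
    simp
  have hsum : Summable F := summable_of_orthogonal
    (fun n m hnm => by rw [hin, ho n m hnm]) (by simpa only [hnorm] using hs)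
  refine ⟨(∑' n, F n : Lp ℂ 2 μ), Lp.memLp _, ?_⟩
  have ht := hsum.hasSum.tendsto_sum_nat
  have he : ∀ M, ∑ n ∈ Finset.range M, F n
      = (memLp_finsetSum (Finset.range M) fun n _ => hf n).toLp _ := fun M =>
    (MemLp.toLp_sum hf _).symm
  simp_rw [he] at ht
  rw [← Lp.toLp_coeFn (∑' n, F n) (Lp.memLp _), Lp.tendsto_Lp_iff_tendsto_eLpNorm''] at ht
  exact ht

theorem TendstoL2.congr_ae {f f' : ℕ → α → ℂ} {g : α → ℂ} (h : TendstoL2 μ f g)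
    (hf : ∀ m, f m =ᵐ[μ] f' m) : TendstoL2 μ f' g :=
  Tendsto.congr (fun m => eLpNorm_congr_ae ((hf m).sub (EventuallyEq.refl _ g))) h

theorem TendstoL2.congr_right {f : ℕ → α → ℂ} {g g' : α → ℂ} (h : TendstoL2 μ f g)
    (hg : g =ᵐ[μ] g') : TendstoL2 μ f g' :=
  Tendsto.congr (fun m => eLpNorm_congr_ae ((EventuallyEq.refl _ (f m)).sub hg)) h

theorem TendstoL2.mono_measure {ν : Measure α} {f : ℕ → α → ℂ} {g : α → ℂ} (h : TendstoL2 μ f g)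
    (hν : ν ≤ μ) : TendstoL2 ν f g :=
  tendsto_of_tendsto_of_tendsto_of_le_of_le tendsto_const_nhds h (fun _ => zero_le)
    fun _ => eLpNorm_mono_measure _ hν

theorem TendstoL2.add {f f' : ℕ → α → ℂ} {g g' : α → ℂ} (h : TendstoL2 μ f g)
    (h' : TendstoL2 μ f' g') (hf : ∀ m, MemLp (f m) 2 μ) (hf' : ∀ m, MemLp (f' m) 2 μ)
    (hg : MemLp g 2 μ) (hg' : MemLp g' 2 μ) :
    TendstoL2 μ (fun m p => f m p + f' m p) (fun p => g p + g' p) := by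
  have := Tendsto.add h h'
  rw [add_zero] at this
  refine tendsto_of_tendsto_of_tendsto_of_le_of_le tendsto_const_nhds this (fun _ => zero_le)
    fun m => ?_
  have e : (fun p => f m p + f' m p - (g p + g' p))
      = (fun p => f m p - g p) + fun p => f' m p - g' p := by
    ext p; simp; ring
  simp only [e]
  exact eLpNorm_add_le ((hf m).sub hg).1 ((hf' m).sub hg').1 (by norm_num)

theorem TendstoL2.const_mul {f : ℕ → α → ℂ} {g : α → ℂ} (h : TendstoL2 μ f g) (c : ℂ) :
    TendstoL2 μ (fun m p => c * f m p) (fun p => c * g p) := by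
  have := ENNReal.Tendsto.const_mul (a := ‖c‖ₑ) h (Or.inr (by simp))
  rw [mul_zero] at this
  refine Tendsto.congr (fun m => ?_) this
  rw [← eLpNorm_const_smul]
  congr 1
  ext p
  simp [mul_sub]

theorem TendstoL2.exists_seq_tendsto_ae {f : ℕ → α → ℂ} {g : α → ℂ} (h : TendstoL2 μ f g)
    (hf : ∀ m, AEStronglyMeasurable (f m) μ) (hg : AEStronglyMeasurable g μ) :
    ∃ ns : ℕ → ℕ, StrictMono ns ∧ ∀ᵐ x ∂μ, Tendsto (fun i => f (ns i) x) atTop (𝓝 (g x)) :=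
  (tendstoInMeasure_of_tendsto_eLpNorm (by norm_num) hf hg h).exists_seq_tendsto_ae

theorem TendstoL2.ae_eq_of_tendsto {f : ℕ → α → ℂ} {g g' : α → ℂ} (h : TendstoL2 μ f g)
    (hf : ∀ m, AEStronglyMeasurable (f m) μ) (hg : AEStronglyMeasurable g μ)
    (h' : ∀ᵐ x ∂μ, Tendsto (fun m => f m x) atTop (𝓝 (g' x))) : g =ᵐ[μ] g' := by
  obtain ⟨ns, hns, ht⟩ := h.exists_seq_tendsto_ae hf hg
  filter_upwards [ht, h'] with x h1 h2
  exact tendsto_nhds_unique h1 (h2.comp hns.tendsto_atTop)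

theorem TendstoL2.unique {f : ℕ → α → ℂ} {g g' : α → ℂ} (h : TendstoL2 μ f g)
    (h' : TendstoL2 μ f g') (hf : ∀ m, AEStronglyMeasurable (f m) μ)
    (hg : AEStronglyMeasurable g μ) (hg' : AEStronglyMeasurable g' μ) : g =ᵐ[μ] g' := by
  have := Tendsto.add h h'
  rw [add_zero] at this
  have h0 : eLpNorm (fun p => g p - g' p) 2 μ = 0 := by
    refine le_antisymm (ge_of_tendsto' this fun m => ?_) zero_le
    have e : (fun p => g p - g' p) = (fun p => f m p - g' p) - fun p => f m p - g p := by
      ext p; simp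
    simp only [e]
    rw [add_comm]
    exact eLpNorm_sub_le ((hf m).sub hg') ((hf m).sub hg) (by norm_num)
  filter_upwards [(eLpNorm_eq_zero_iff (hg.sub hg') (by norm_num)).1 h0] with x hx
  exact sub_eq_zero.1 hx

/-- Integration against a bounded function is continuous on `L²` of a finite measure. -/
theorem TendstoL2.tendsto_integral_smul [IsFiniteMeasure μ] {f : ℕ → α → ℂ} {g : α → ℂ}
    (h : TendstoL2 μ f g) (hf : ∀ m, MemLp (f m) 2 μ) (hg : MemLp g 2 μ) {ψ : α → ℝ}
    (hψ : AEStronglyMeasurable ψ μ) {B : ℝ} (hB : ∀ x, ‖ψ x‖ ≤ B) :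
    Tendsto (fun m => ∫ x, ψ x • f m x ∂μ) atTop (𝓝 (∫ x, ψ x • g x ∂μ)) := by
  have hint : ∀ {u : α → ℂ}, MemLp u 2 μ → Integrable (fun x => ψ x • u x) μ := fun hu =>
    (hu.integrable (by norm_num)).bdd_smul B hψ (ae_of_all _ hB)
  refine tendsto_integral_of_L1' _ (hint hg).1 (Eventually.of_forall fun m => hint (hf m)) ?_
  have hlim := ENNReal.Tendsto.const_mul (a := ENNReal.ofReal B * μ univ ^ (1 / 2 : ℝ)) h
    (Or.inr (ENNReal.mul_ne_top ENNReal.ofReal_ne_top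
      (ENNReal.rpow_ne_top_of_nonneg (by norm_num) (measure_ne_top μ _))))
  rw [mul_zero] at hlim
  refine tendsto_of_tendsto_of_tendsto_of_le_of_le tendsto_const_nhds hlim (fun _ => zero_le)
    fun m => ?_
  have h1 : eLpNorm ((fun x => ψ x • f m x) - fun x => ψ x • g x) 1 μ
      ≤ ENNReal.ofReal B * eLpNorm (fun x => f m x - g x) 1 μ := by
    refine eLpNorm_le_mul_eLpNorm_of_ae_le_mul (ae_of_all _ fun x => ?_) 1
    simp only [Pi.sub_apply]
    rw [← smul_sub, norm_smul]
    exact mul_le_mul_of_nonneg_right (hB x) (norm_nonneg _)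
  refine h1.trans ?_
  have h2 := eLpNorm_le_eLpNorm_mul_rpow_measure_univ (μ := μ) (p := 1) (q := 2) (by norm_num)
    ((hf m).sub hg).1
  rw [mul_assoc]
  refine mul_le_mul_right (h2.trans_eq ?_) _
  rw [mul_comm]
  norm_num
  rfl

end L2

/-! ### The unit square -/

theorem measurableSet_Ω : MeasurableSet Ω := measurableSet_Ioo.prod measurableSet_Ioo

theorem isOpen_Ω : IsOpen Ω := isOpen_Ioo.prod isOpen_Ioo

theorem areaΩ_eq_prod : areaΩ
    = (volume.restrict (Ioo (0 : ℝ) 1)).prod (volume.restrict (Ioo (0 : ℝ) 1)) := by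
  rw [Measure.prod_restrict]; rfl

instance : IsFiniteMeasure areaΩ := by
  rw [areaΩ_eq_prod]; infer_instance

instance : IsFiniteMeasure arcΩ := by
  unfold arcΩ; infer_instance

theorem ae_arcΩ_mem : ∀ᵐ p ∂arcΩ, p ∈ Icc (0 : ℝ) 1 ×ˢ Icc (0 : ℝ) 1 := by
  have hm : MeasurableSet (Icc (0 : ℝ) 1 ×ˢ Icc (0 : ℝ) 1) :=
    measurableSet_Icc.prod measurableSet_Icc
  have key : ∀ f : ℝ → ℝ × ℝ, Measurable f →
      (∀ t ∈ Ioo (0 : ℝ) 1, f t ∈ Icc (0 : ℝ) 1 ×ˢ Icc (0 : ℝ) 1) →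
      ∀ᵐ p ∂(volume.restrict (Ioo (0 : ℝ) 1)).map f, p ∈ Icc (0 : ℝ) 1 ×ˢ Icc (0 : ℝ) 1 := by
    intro f hf h
    refine (ae_map_iff hf.aemeasurable hm).2 ?_
    filter_upwards [ae_restrict_mem measurableSet_Ioo] with t ht using h t ht
  unfold arcΩ
  simp only [ae_add_measure_iff]
  refine ⟨⟨⟨?_, ?_⟩, ?_⟩, ?_⟩ <;> refine key _ (by fun_prop) fun t ht => ?_ <;>
    exact ⟨⟨by simp [ht.1.le], by simp [ht.2.le]⟩, ⟨by simp [ht.1.le], by simp [ht.2.le]⟩⟩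

theorem memLp_of_continuous_of_ae_mem {μ : Measure (ℝ × ℝ)} [IsFiniteMeasure μ]
    (hμ : ∀ᵐ p ∂μ, p ∈ Icc (0 : ℝ) 1 ×ˢ Icc (0 : ℝ) 1) {f : ℝ × ℝ → ℂ} (hf : Continuous f) :
    MemLp f 2 μ := by
  obtain ⟨C, hC⟩ := ((isCompact_Icc (a := (0 : ℝ)) (b := 1)).prod
    (isCompact_Icc (a := (0 : ℝ)) (b := 1))).exists_bound_of_continuousOn hf.continuousOn
  exact MemLp.of_bound hf.aestronglyMeasurable C (hμ.mono fun p hp => hC p hp)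

theorem ae_areaΩ_mem : ∀ᵐ p ∂areaΩ, p ∈ Icc (0 : ℝ) 1 ×ˢ Icc (0 : ℝ) 1 := by
  filter_upwards [ae_restrict_mem measurableSet_Ω] with p hp
  exact ⟨Ioo_subset_Icc_self hp.1, Ioo_subset_Icc_self hp.2⟩

theorem Continuous.memLp_areaΩ {f : ℝ × ℝ → ℂ} (hf : Continuous f) : MemLp f 2 areaΩ :=
  memLp_of_continuous_of_ae_mem ae_areaΩ_mem hf

theorem Continuous.memLp_arcΩ {f : ℝ × ℝ → ℂ} (hf : Continuous f) : MemLp f 2 arcΩ :=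
  memLp_of_continuous_of_ae_mem ae_arcΩ_mem hf

theorem Continuous.memLp_Ioo {f : ℝ → ℂ} (hf : Continuous f) :
    MemLp f 2 (volume.restrict (Ioo (0 : ℝ) 1)) := by
  obtain ⟨C, hC⟩ := (isCompact_Icc (a := (0 : ℝ)) (b := 1)).exists_bound_of_continuousOn
    hf.continuousOn
  refine MemLp.of_bound hf.aestronglyMeasurable C ?_
  filter_upwards [ae_restrict_mem measurableSet_Ioo] with x hx using hC x (Ioo_subset_Icc_self hx)

/-- Smooth functions have their classical derivatives as weak derivatives. -/
theorem isWeakDeriv_fderiv {v : ℝ × ℝ → ℂ} (hv : ContDiff ℝ ∞ v) (e : ℝ × ℝ) :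
    IsWeakDeriv e v (fun p => fderiv ℝ v p e) := by
  intro φ hφ hc hs
  have hφc : Continuous fun p => fderiv ℝ φ p e :=
    (hφ.continuous_fderiv (by simp)).clm_apply continuous_const
  have hvc : Continuous fun p => fderiv ℝ v p e :=
    (hv.continuous_fderiv (by simp)).clm_apply continuous_const
  have z1 : ∀ p ∉ Ω, fderiv ℝ φ p e • v p = 0 := fun p hp => by
    have : fderiv ℝ φ p = 0 := image_eq_zero_of_notMem_tsupport
      fun h => hp (hs (tsupport_fderiv_subset ℝ h))
    rw [this]; simp
  have z2 : ∀ p ∉ Ω, φ p • fderiv ℝ v p e = 0 := fun p hp => by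
    rw [image_eq_zero_of_notMem_tsupport fun h => hp (hs h), zero_smul]
  unfold areaΩ
  rw [setIntegral_eq_integral_of_forall_compl_eq_zero z1,
    setIntegral_eq_integral_of_forall_compl_eq_zero z2]
  have hi : ∀ (a : ℝ × ℝ → ℝ) (b : ℝ × ℝ → ℂ), Continuous a → HasCompactSupport a →
      Continuous b → Integrable (fun p => a p • b p) := fun a b ha hac hb =>
    (ha.smul hb).integrable_of_hasCompactSupport hac.smul_right
  rw [integral_smul_fderiv_eq_neg_fderiv_smul_of_integrable
    (hi _ _ hφc (hc.fderiv_apply ℝ e) hv.continuous) (hi _ _ hφ.continuous hc hvc)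
    (hi _ _ hφ.continuous hc hv.continuous) (fun x _ => hφ.differentiable (by simp) x)
    (fun x _ => hv.differentiable (by simp) x), neg_neg]

/-- Both sides of the integration by parts formula are continuous in `L²(Ω)`, since the test
function and its derivative are bounded. -/
theorem isWeakDeriv_of_tendstoL2 {v : ℕ → ℝ × ℝ → ℂ} (hv : ∀ m, ContDiff ℝ ∞ (v m))
    {e : ℝ × ℝ} {u w : ℝ × ℝ → ℂ} (hu : MemLp u 2 areaΩ) (hw : MemLp w 2 areaΩ)
    (hvu : TendstoL2 areaΩ v u)
    (hvw : TendstoL2 areaΩ (fun m p => fderiv ℝ (v m) p e) w) : IsWeakDeriv e u w := by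
  intro φ hφ hc hs
  have hφc : Continuous fun p => fderiv ℝ φ p e :=
    (hφ.continuous_fderiv (by simp)).clm_apply continuous_const
  obtain ⟨B, hB⟩ := hc.exists_bound_of_continuous hφ.continuous
  obtain ⟨B', hB'⟩ := (hc.fderiv_apply ℝ e).exists_bound_of_continuous hφc
  have hvc : ∀ m, Continuous fun p => fderiv ℝ (v m) p e := fun m =>
    ((hv m).continuous_fderiv (by simp)).clm_apply continuous_const
  have t1 := hvu.tendsto_integral_smul (fun m => (hv m).continuous.memLp_areaΩ) hu
    hφc.aestronglyMeasurable hB'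
  have t2 := hvw.tendsto_integral_smul (fun m => (hvc m).memLp_areaΩ) hw
    hφ.continuous.aestronglyMeasurable hB
  refine tendsto_nhds_unique t1 (t2.neg.congr fun m => ?_)
  exact (isWeakDeriv_fderiv (hv m) e φ hφ hc hs).symm

theorem hasH1Gradient_of_tendsto {v : ℕ → ℝ × ℝ → ℂ} (hv : ∀ m, ContDiff ℝ ∞ (v m))
    {u ux uy : ℝ × ℝ → ℂ} (hu : MemLp u 2 areaΩ) (hux : MemLp ux 2 areaΩ) (huy : MemLp uy 2 areaΩ)
    (h : TendstoH1 v u ux uy) : HasH1Gradient u ux uy where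
  memLp := hu
  memLp_x := hux
  memLp_y := huy
  weak_x := isWeakDeriv_of_tendstoL2 hv hu hux h.1 h.2.1
  weak_y := isWeakDeriv_of_tendstoL2 hv hu huy h.1 h.2.2

/-! ### Separated series -/

/-- The partial sums of `∑ cₙ eₙ(x) Wₙ(y)`. -/
noncomputable def sepSum (c : ℕ → ℂ) (e : ℕ → ℝ → ℝ) (W : ℕ → ℝ → ℂ) (M : ℕ) (p : ℝ × ℝ) : ℂ :=
  ∑ n ∈ Finset.range M, c n * (e n p.1 : ℂ) * W n p.2

theorem contDiff_sepSum {c : ℕ → ℂ} {e : ℕ → ℝ → ℝ} {W : ℕ → ℝ → ℂ}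
    (he : ∀ n, ContDiff ℝ ∞ (e n)) (hW : ∀ n, ContDiff ℝ ∞ (W n)) (M : ℕ) :
    ContDiff ℝ ∞ (sepSum c e W M) := by
  refine ContDiff.sum fun n _ => ?_
  exact (contDiff_const.mul (Complex.ofRealCLM.contDiff.comp ((he n).comp contDiff_fst))).mul
    ((hW n).comp contDiff_snd)

theorem fderiv_sepSum_x {c : ℕ → ℂ} {e e' : ℕ → ℝ → ℝ} {W : ℕ → ℝ → ℂ}
    {b : ℕ → ℝ} (he : ∀ n x, HasDerivAt (e n) (b n * e' n x) x) (hec : ∀ n, ContDiff ℝ ∞ (e n))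
    (hW : ∀ n, ContDiff ℝ ∞ (W n)) (M : ℕ) (p : ℝ × ℝ) :
    fderiv ℝ (sepSum c e W M) p (1, 0) = sepSum (fun n => c n * b n) e' W M p := by
  have hd := ((contDiff_sepSum (c := c) hec hW M).differentiable (by simp) p).hasFDerivAt
  have hl : HasDerivAt (fun t : ℝ => (t, p.2)) (1, 0) p.1 :=
    (hasDerivAt_id p.1).prodMk (hasDerivAt_const p.1 p.2)
  have h1 := HasFDerivAt.comp_hasDerivAt (f := fun t : ℝ => (t, p.2)) p.1 hd hl
  refine h1.unique ?_
  refine (HasDerivAt.fun_sum (u := Finset.range M)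
    (A := fun n t => c n * (e n t : ℂ) * W n p.2) fun n _ =>
    (((he n p.1).ofReal_comp.const_mul (c n)).mul_const (W n p.2))).congr_deriv ?_
  refine Finset.sum_congr rfl fun n _ => ?_
  push_cast
  ring

theorem fderiv_sepSum_y {c : ℕ → ℂ} {e : ℕ → ℝ → ℝ} {W W' : ℕ → ℝ → ℂ}
    {b : ℕ → ℂ} (hWd : ∀ n y, HasDerivAt (W n) (b n * W' n y) y) (hec : ∀ n, ContDiff ℝ ∞ (e n))
    (hW : ∀ n, ContDiff ℝ ∞ (W n)) (M : ℕ) (p : ℝ × ℝ) :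
    fderiv ℝ (sepSum c e W M) p (0, 1) = sepSum (fun n => c n * b n) e W' M p := by
  have hd := ((contDiff_sepSum (c := c) hec hW M).differentiable (by simp) p).hasFDerivAt
  have hl : HasDerivAt (fun t : ℝ => (p.1, t)) (0, 1) p.2 :=
    (hasDerivAt_const p.2 p.1).prodMk (hasDerivAt_id p.2)
  have h1 := HasFDerivAt.comp_hasDerivAt (f := fun t : ℝ => (p.1, t)) p.2 hd hl
  refine h1.unique ?_
  refine (HasDerivAt.fun_sum (u := Finset.range M)
    (A := fun n t => c n * (e n p.1 : ℂ) * W n t) fun n _ =>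
    ((hWd n p.2).const_mul (c n * (e n p.1 : ℂ)))).congr_deriv ?_
  refine Finset.sum_congr rfl fun n _ => ?_
  ring

/-- By Fubini, orthogonality of the `eₙ` in `x` alone makes the terms orthogonal on `Ω`, whatever
the factors `Wₙ(y)`. The bound `|eₙ| ≤ 2` replaces normalization. -/
theorem exists_tendstoL2_sepSum {c : ℕ → ℂ} {e : ℕ → ℝ → ℝ} {W : ℕ → ℝ → ℂ}
    (he : ∀ n, Continuous (e n)) (heb : ∀ n x, |e n x| ≤ 2)
    (heo : ∀ n m, n ≠ m → ∫ x in Ioo (0 : ℝ) 1, e n x * e m x = 0)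
    (hW : ∀ n, Continuous (W n))
    (hs : Summable fun n => ‖c n‖ ^ 2 * ∫ y in Ioo (0 : ℝ) 1, ‖W n y‖ ^ 2) :
    ∃ u, MemLp u 2 areaΩ ∧ TendstoL2 areaΩ (sepSum c e W) u := by
  have hc : ∀ n, Continuous fun p : ℝ × ℝ => c n * (e n p.1 : ℂ) * W n p.2 := fun n => by
    have := he n; have := hW n; fun_prop
  refine exists_tendstoL2_of_orthogonal (fun n => (hc n).memLp_areaΩ) (fun n m hnm => ?_) ?_
  · have e1 : ∀ p : ℝ × ℝ, c m * (e m p.1 : ℂ) * W m p.2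
        * (starRingEnd ℂ) (c n * (e n p.1 : ℂ) * W n p.2)
        = ((e m p.1 * e n p.1 : ℝ) : ℂ)
          * (c m * W m p.2 * (starRingEnd ℂ) (c n * W n p.2)) := by
      intro p
      simp only [map_mul, Complex.conj_ofReal]
      push_cast
      ring
    simp_rw [e1]
    rw [areaΩ_eq_prod, integral_prod_mul (fun x => ((e m x * e n x : ℝ) : ℂ))
      (fun y => c m * W m y * (starRingEnd ℂ) (c n * W n y)), integral_complex_ofReal,
      heo m n hnm.symm]
    simp
  · refine Summable.of_nonneg_of_le (fun n => integral_nonneg fun _ => sq_nonneg _)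
      (fun n => ?_) (hs.mul_left 4)
    have e1 : ∀ p : ℝ × ℝ, ‖c n * (e n p.1 : ℂ) * W n p.2‖ ^ 2
        = (e n p.1 ^ 2) * (‖c n‖ ^ 2 * ‖W n p.2‖ ^ 2) := by
      intro p
      rw [norm_mul, norm_mul, Complex.norm_real, mul_pow, mul_pow, Real.norm_eq_abs, sq_abs]
      ring
    simp_rw [e1]
    rw [areaΩ_eq_prod, integral_prod_mul (fun x => e n x ^ 2) (fun y => ‖c n‖ ^ 2 * ‖W n y‖ ^ 2),
      integral_const_mul]
    refine mul_le_mul_of_nonneg_right ?_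
      (mul_nonneg (sq_nonneg _) (integral_nonneg fun _ => sq_nonneg _))
    have : ∫ x in Ioo (0 : ℝ) 1, e n x ^ 2 ≤ ∫ x in Ioo (0 : ℝ) 1, (4 : ℝ) := by
      refine integral_mono_of_nonneg (ae_of_all _ fun _ => sq_nonneg _) (integrable_const _)
        (ae_of_all _ fun x => ?_)
      have := sq_le_sq' (by linarith [(abs_le.1 (heb n x)).1]) (abs_le.1 (heb n x)).2
      simp only
      linarith
    simpa using this

open scoped ENNReal

/-! ### Traces -/

theorem ENNReal.add_sq_le (a b : ℝ≥0∞) : (a + b) ^ 2 ≤ 2 * a ^ 2 + 2 * b ^ 2 := by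
  have := ENNReal.rpow_add_le_mul_rpow_add_rpow a b (p := 2) (by norm_num)
  norm_num at this
  rwa [mul_add] at this

theorem eLpNorm_two_sq {α E : Type*} [MeasurableSpace α] [NormedAddCommGroup E] {μ : Measure α}
    (f : α → E) : eLpNorm f 2 μ ^ 2 = ∫⁻ x, ‖f x‖ₑ ^ 2 ∂μ := by
  have := eLpNorm_nnreal_pow_eq_lintegral (f := f) (μ := μ) (p := 2) (by norm_num)
  simpa using this

theorem Continuous.enorm_sq {α : Type*} [TopologicalSpace α] {f : α → ℂ} (hf : Continuous f) :
    Continuous fun x => ‖f x‖ₑ ^ 2 :=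
  (ENNReal.continuous_pow 2).comp hf.enorm

theorem lintegral_enorm_sq_le {E : Type*} [NormedAddCommGroup E] {f : ℝ → E}
    (hf : AEStronglyMeasurable f (volume.restrict (Ioo (0 : ℝ) 1))) :
    (∫⁻ x in Ioo (0 : ℝ) 1, ‖f x‖ₑ) ^ 2 ≤ ∫⁻ x in Ioo (0 : ℝ) 1, ‖f x‖ₑ ^ 2 := by
  have : IsProbabilityMeasure (volume.restrict (Ioo (0 : ℝ) 1)) := ⟨by simp⟩
  rw [← eLpNorm_two_sq, ← eLpNorm_one_eq_lintegral_enorm]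
  gcongr
  exact eLpNorm_le_eLpNorm_of_exponent_le (by norm_num) hf

theorem enorm_sub_le_lintegral {f f' : ℝ → ℂ} (hf : ∀ x, HasDerivAt f (f' x) x)
    (hc : Continuous f') {a b : ℝ} (ha : a ∈ Icc (0 : ℝ) 1) (hb : b ∈ Icc (0 : ℝ) 1) :
    ‖f b - f a‖ₑ ≤ ∫⁻ x in Ioo (0 : ℝ) 1, ‖f' x‖ₑ := by
  rw [← intervalIntegral.integral_eq_sub_of_hasDerivAt (fun x _ => hf x)
    (hc.intervalIntegrable a b)]
  have : ‖∫ x in a..b, f' x‖ₑ = ‖∫ x in uIoc a b, f' x‖ₑ := by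
    rw [← ofReal_norm, ← ofReal_norm, intervalIntegral.norm_intervalIntegral_eq]
  rw [this]
  refine (enorm_integral_le_lintegral_enorm _).trans ?_
  rw [Measure.restrict_congr_set (Ioo_ae_eq_Ioc (a := (0 : ℝ)) (b := 1))]
  exact lintegral_mono_set (Ioc_subset_Ioc (le_min ha.1 hb.1) (max_le ha.2 hb.2))

/-- The one-dimensional Sobolev inequality. -/
theorem enorm_sq_le_lintegral {f f' : ℝ → ℂ} (hf : ∀ x, HasDerivAt f (f' x) x)
    (hc : Continuous f') {a : ℝ} (ha : a ∈ Icc (0 : ℝ) 1) :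
    ‖f a‖ₑ ^ 2 ≤ 2 * (∫⁻ x in Ioo (0 : ℝ) 1, ‖f x‖ₑ ^ 2)
      + 2 * ∫⁻ x in Ioo (0 : ℝ) 1, ‖f' x‖ₑ ^ 2 := by
  have hfc : Continuous f := continuous_iff_continuousAt.2 fun x => (hf x).continuousAt
  calc ‖f a‖ₑ ^ 2 = ∫⁻ _x in Ioo (0 : ℝ) 1, ‖f a‖ₑ ^ 2 := by simp
    _ ≤ ∫⁻ x in Ioo (0 : ℝ) 1,
        (2 * ‖f x‖ₑ ^ 2 + 2 * ∫⁻ x in Ioo (0 : ℝ) 1, ‖f' x‖ₑ ^ 2) := by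
        refine setLIntegral_mono (by fun_prop) fun x hx => ?_
        have h1 : ‖f a‖ₑ ≤ ‖f x‖ₑ + ∫⁻ x in Ioo (0 : ℝ) 1, ‖f' x‖ₑ := by
          calc ‖f a‖ₑ = ‖f x + (f a - f x)‖ₑ := by simp
            _ ≤ ‖f x‖ₑ + ‖f a - f x‖ₑ := enorm_add_le _ _
            _ ≤ _ := by
              gcongr
              exact enorm_sub_le_lintegral hf hc (Ioo_subset_Icc_self hx) ha
        refine (pow_le_pow_left' h1 2).trans ((ENNReal.add_sq_le _ _).trans ?_)
        gcongr
        exact lintegral_enorm_sq_le hc.aestronglyMeasurable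
    _ = _ := by
        rw [lintegral_add_left (by fun_prop), lintegral_const_mul _ (by fun_prop)]
        simp

/-- `∫ w ≤ K` on each horizontal and vertical segment of the closed square. -/
def LineBound (w : ℝ × ℝ → ℝ≥0∞) (K : ℝ≥0∞) : Prop :=
  (∀ x ∈ Icc (0 : ℝ) 1, ∫⁻ y in Ioo (0 : ℝ) 1, w (x, y) ≤ K) ∧
  (∀ y ∈ Icc (0 : ℝ) 1, ∫⁻ x in Ioo (0 : ℝ) 1, w (x, y) ≤ K)

theorem LineBound.add {w w' : ℝ × ℝ → ℝ≥0∞} {K K' : ℝ≥0∞} (h : LineBound w K)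
    (h' : LineBound w' K') (hw : Measurable w) : LineBound (fun p => w p + w' p) (K + K') := by
  refine ⟨fun x hx => ?_, fun y hy => ?_⟩
  · rw [lintegral_add_left (by fun_prop)]
    exact add_le_add (h.1 x hx) (h'.1 x hx)
  · rw [lintegral_add_left (by fun_prop)]
    exact add_le_add (h.2 y hy) (h'.2 y hy)

theorem LineBound.mono {w : ℝ × ℝ → ℝ≥0∞} {K K' : ℝ≥0∞} (h : LineBound w K)
    (hK : K ≤ K') : LineBound w K' :=
  ⟨fun x hx => (h.1 x hx).trans hK, fun y hy => (h.2 y hy).trans hK⟩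

theorem LineBound.lintegral_arcΩ_le {w : ℝ × ℝ → ℝ≥0∞} {K : ℝ≥0∞} (h : LineBound w K)
    (hw : Measurable w) : ∫⁻ p, w p ∂arcΩ ≤ 4 * K := by
  have h0 : (0 : ℝ) ∈ Icc (0 : ℝ) 1 := ⟨le_rfl, zero_le_one⟩
  have h1 : (1 : ℝ) ∈ Icc (0 : ℝ) 1 := ⟨zero_le_one, le_rfl⟩
  unfold arcΩ
  rw [lintegral_add_measure, lintegral_add_measure, lintegral_add_measure,
    lintegral_map hw (by fun_prop), lintegral_map hw (by fun_prop), lintegral_map hw (by fun_prop),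
    lintegral_map hw (by fun_prop)]
  calc _ ≤ K + K + K + K := by
        gcongr
        exacts [h.2 0 h0, h.1 1 h1, h.2 1 h1, h.1 0 h0]
    _ = 4 * K := by ring

theorem hasDerivAt_slice_x {v : ℝ × ℝ → ℂ} (hv : ContDiff ℝ ∞ v) (x y : ℝ) :
    HasDerivAt (fun t => v (t, y)) (fderiv ℝ v (x, y) (1, 0)) x :=
  HasFDerivAt.comp_hasDerivAt (f := fun t : ℝ => (t, y)) x
    (hv.differentiable (by simp) (x, y)).hasFDerivAt
    ((hasDerivAt_id x).prodMk (hasDerivAt_const x y))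

theorem hasDerivAt_slice_y {v : ℝ × ℝ → ℂ} (hv : ContDiff ℝ ∞ v) (x y : ℝ) :
    HasDerivAt (fun t => v (x, t)) (fderiv ℝ v (x, y) (0, 1)) y :=
  HasFDerivAt.comp_hasDerivAt (f := fun t : ℝ => (x, t)) y
    (hv.differentiable (by simp) (x, y)).hasFDerivAt
    ((hasDerivAt_const y x).prodMk (hasDerivAt_id y))

theorem continuous_fderiv_apply_const {v : ℝ × ℝ → ℂ} (hv : ContDiff ℝ ∞ v) (e : ℝ × ℝ) :
    Continuous fun p => fderiv ℝ v p e :=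
  (hv.continuous_fderiv (by simp)).clm_apply continuous_const

/-- The square of the `H¹(Ω)` norm of a smooth function. -/
noncomputable def sqNormH1 (v : ℝ × ℝ → ℂ) : ℝ≥0∞ :=
  eLpNorm v 2 areaΩ ^ 2 + eLpNorm (fun p => fderiv ℝ v p (1, 0)) 2 areaΩ ^ 2
    + eLpNorm (fun p => fderiv ℝ v p (0, 1)) 2 areaΩ ^ 2

/-- The trace inequality on each segment. -/
theorem lineBound_enorm_sq {v : ℝ × ℝ → ℂ} (hv : ContDiff ℝ ∞ v) :
    LineBound (fun p => ‖v p‖ₑ ^ 2) (2 * sqNormH1 v) := by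
  have hc := hv.continuous
  have hx := continuous_fderiv_apply_const hv (1, 0)
  have hy := continuous_fderiv_apply_const hv (0, 1)
  have m : ∀ {f : ℝ × ℝ → ℂ}, Continuous f → Measurable fun p => ‖f p‖ₑ ^ 2 := fun hf =>
    hf.enorm_sq.measurable
  constructor
  · intro x0 hx0
    calc ∫⁻ y in Ioo (0 : ℝ) 1, ‖v (x0, y)‖ₑ ^ 2
        ≤ ∫⁻ y in Ioo (0 : ℝ) 1, (2 * (∫⁻ x in Ioo (0 : ℝ) 1, ‖v (x, y)‖ₑ ^ 2)
          + 2 * ∫⁻ x in Ioo (0 : ℝ) 1, ‖fderiv ℝ v (x, y) (1, 0)‖ₑ ^ 2) :=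
          lintegral_mono fun y => enorm_sq_le_lintegral (fun x => hasDerivAt_slice_x hv x y)
            (hx.comp (by fun_prop : Continuous fun x : ℝ => (x, y))) hx0
      _ = 2 * eLpNorm v 2 areaΩ ^ 2
          + 2 * eLpNorm (fun p => fderiv ℝ v p (1, 0)) 2 areaΩ ^ 2 := by
          have m1 := Measurable.lintegral_prod_left' (μ := volume.restrict (Ioo (0 : ℝ) 1)) (m hc)
          have m2 := Measurable.lintegral_prod_left' (μ := volume.restrict (Ioo (0 : ℝ) 1)) (m hx)
          rw [eLpNorm_two_sq, eLpNorm_two_sq, areaΩ_eq_prod,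
            lintegral_prod_symm _ (m hc).aemeasurable, lintegral_prod_symm _ (m hx).aemeasurable,
            lintegral_add_left (m1.const_mul 2), lintegral_const_mul _ m1, lintegral_const_mul _ m2]
      _ ≤ 2 * sqNormH1 v := by
          rw [← mul_add]
          gcongr
          exact le_self_add
  · intro y0 hy0
    calc ∫⁻ x in Ioo (0 : ℝ) 1, ‖v (x, y0)‖ₑ ^ 2
        ≤ ∫⁻ x in Ioo (0 : ℝ) 1, (2 * (∫⁻ y in Ioo (0 : ℝ) 1, ‖v (x, y)‖ₑ ^ 2)
          + 2 * ∫⁻ y in Ioo (0 : ℝ) 1, ‖fderiv ℝ v (x, y) (0, 1)‖ₑ ^ 2) :=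
          lintegral_mono fun x => enorm_sq_le_lintegral (fun y => hasDerivAt_slice_y hv x y)
            (hy.comp (by fun_prop : Continuous fun y : ℝ => (x, y))) hy0
      _ = 2 * eLpNorm v 2 areaΩ ^ 2
          + 2 * eLpNorm (fun p => fderiv ℝ v p (0, 1)) 2 areaΩ ^ 2 := by
          have m1 := Measurable.lintegral_prod_right' (ν := volume.restrict (Ioo (0 : ℝ) 1)) (m hc)
          have m2 := Measurable.lintegral_prod_right' (ν := volume.restrict (Ioo (0 : ℝ) 1)) (m hy)
          rw [eLpNorm_two_sq, eLpNorm_two_sq, areaΩ_eq_prod,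
            lintegral_prod _ (m hc).aemeasurable, lintegral_prod _ (m hy).aemeasurable,
            lintegral_add_left (m1.const_mul 2), lintegral_const_mul _ m1, lintegral_const_mul _ m2]
      _ ≤ 2 * sqNormH1 v := by
          rw [← mul_add]
          gcongr
          exact add_le_add_left le_self_add _

theorem eLpNorm_arcΩ_sq_le {v : ℝ × ℝ → ℂ} (hv : ContDiff ℝ ∞ v) :
    eLpNorm v 2 arcΩ ^ 2 ≤ 8 * sqNormH1 v := by
  rw [eLpNorm_two_sq]
  refine ((lineBound_enorm_sq hv).lintegral_arcΩ_le hv.continuous.enorm_sq.measurable).trans ?_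
  rw [← mul_assoc]
  norm_num

theorem sqNormH1_sub_le {v w u ux uy : ℝ × ℝ → ℂ} (hv : ContDiff ℝ ∞ v) (hw : ContDiff ℝ ∞ w)
    (hu : MemLp u 2 areaΩ) (hux : MemLp ux 2 areaΩ) (huy : MemLp uy 2 areaΩ) :
    sqNormH1 (fun p => v p - w p) ≤
      ((eLpNorm (fun p => v p - u p) 2 areaΩ + eLpNorm (fun p => fderiv ℝ v p (1, 0) - ux p) 2 areaΩ
          + eLpNorm (fun p => fderiv ℝ v p (0, 1) - uy p) 2 areaΩ)
        + (eLpNorm (fun p => w p - u p) 2 areaΩ + eLpNorm (fun p => fderiv ℝ w p (1, 0) - ux p) 2 areaΩ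
          + eLpNorm (fun p => fderiv ℝ w p (0, 1) - uy p) 2 areaΩ)) ^ 2 := by
  have tri : ∀ {f g h : ℝ × ℝ → ℂ}, Continuous f → Continuous g → MemLp h 2 areaΩ →
      eLpNorm (fun p => f p - g p) 2 areaΩ
        ≤ eLpNorm (fun p => f p - h p) 2 areaΩ + eLpNorm (fun p => g p - h p) 2 areaΩ := by
    intro f g h hf hg hh
    have e : (fun p => f p - g p) = (fun p => f p - h p) - fun p => g p - h p := by
      ext p; simp
    rw [e]
    exact eLpNorm_sub_le (hf.memLp_areaΩ.sub hh).1 (hg.memLp_areaΩ.sub hh).1 (by norm_num)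
  have hd : ∀ e p, fderiv ℝ (fun p => v p - w p) p e = fderiv ℝ v p e - fderiv ℝ w p e := by
    intro e p
    rw [fderiv_fun_sub (hv.differentiable (by simp) p) (hw.differentiable (by simp) p)]
    rfl
  unfold sqNormH1
  simp_rw [hd]
  have t0 := tri hv.continuous hw.continuous hu
  have t1 := tri (continuous_fderiv_apply_const hv (1, 0)) (continuous_fderiv_apply_const hw (1, 0)) hux
  have t2 := tri (continuous_fderiv_apply_const hv (0, 1)) (continuous_fderiv_apply_const hw (0, 1)) huy
  have hsq : ∀ a b c : ℝ≥0∞, a ^ 2 + b ^ 2 + c ^ 2 ≤ (a + b + c) ^ 2 := by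
    intro a b c
    calc a ^ 2 + b ^ 2 + c ^ 2 ≤ a ^ 2 + b ^ 2 + c ^ 2 + 2 * (a * b + b * c + a * c) := le_self_add
      _ = (a + b + c) ^ 2 := by ring
  refine (hsq _ _ _).trans (pow_le_pow_left' ((add_le_add (add_le_add t0 t1) t2).trans_eq ?_) 2)
  ring

/-- Smooth functions converging in `H¹(Ω)` have converging boundary values. -/
theorem exists_trace {v : ℕ → ℝ × ℝ → ℂ} (hv : ∀ m, ContDiff ℝ ∞ (v m))
    {u ux uy : ℝ × ℝ → ℂ} (hu : MemLp u 2 areaΩ) (hux : MemLp ux 2 areaΩ) (huy : MemLp uy 2 areaΩ)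
    (h : TendstoH1 v u ux uy) : ∃ φ, MemLp φ 2 arcΩ ∧ TendstoL2 arcΩ v φ := by
  set s : ℕ → ℝ≥0∞ := fun m =>
    eLpNorm (fun p => v m p - u p) 2 areaΩ + eLpNorm (fun p => fderiv ℝ (v m) p (1, 0) - ux p) 2 areaΩ
      + eLpNorm (fun p => fderiv ℝ (v m) p (0, 1) - uy p) 2 areaΩ with hs
  have hs0 : Tendsto (fun m => 3 * s m) atTop (𝓝 0) := by
    have := ENNReal.Tendsto.const_mul (a := 3) ((h.1.add h.2.1).add h.2.2) (Or.inr (by simp))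
    simpa using this
  have hm : ∀ m, MemLp (v m) 2 arcΩ := fun m => (hv m).continuous.memLp_arcΩ
  have hle : ∀ m l, eLpNorm (v m - v l) 2 arcΩ ≤ 3 * s m + 3 * s l := by
    intro m l
    -- After squaring, the trace constant 8 is at most `3²`.
    rw [← mul_add, ← ENNReal.pow_le_pow_left_iff (two_ne_zero)]
    refine (eLpNorm_arcΩ_sq_le ((hv m).sub (hv l))).trans ?_
    rw [mul_pow]
    refine mul_le_mul' (by norm_num) ?_
    exact sqNormH1_sub_le (hv m) (hv l) hu hux huy
  have hcau : CauchySeq fun m => (hm m).toLp (v m) := by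
    rw [EMetric.cauchySeq_iff]
    intro ε hε
    have := (hs0.eventually (gt_mem_nhds (ENNReal.half_pos hε.ne'))).exists_forall_of_atTop
    obtain ⟨N, hN⟩ := this
    refine ⟨N, fun m hm' l hl => ?_⟩
    rw [Lp.edist_toLp_toLp]
    refine (hle m l).trans_lt ?_
    rw [← ENNReal.add_halves ε]
    exact ENNReal.add_lt_add (hN m hm') (hN l hl)
  obtain ⟨F, hF⟩ := cauchySeq_tendsto_of_complete hcau
  refine ⟨F, Lp.memLp F, ?_⟩
  rw [← Lp.toLp_coeFn F (Lp.memLp _), Lp.tendsto_Lp_iff_tendsto_eLpNorm''] at hF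
  exact hF

theorem map_bottom_le_arcΩ :
    (volume.restrict (Ioo (0 : ℝ) 1)).map (fun t => (t, (0 : ℝ))) ≤ arcΩ := by
  unfold arcΩ
  rw [add_assoc, add_assoc]
  exact Measure.le_add_right le_rfl

theorem map_top_le_arcΩ :
    (volume.restrict (Ioo (0 : ℝ) 1)).map (fun t => (t, (1 : ℝ))) ≤ arcΩ := by
  unfold arcΩ
  exact Measure.le_add_right (Measure.le_add_left le_rfl)

theorem TendstoL2.comp_of_map_le {v : ℕ → ℝ × ℝ → ℂ} {φ : ℝ × ℝ → ℂ} (h : TendstoL2 arcΩ v φ)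
    (hv : ∀ m, Continuous (v m)) (hφ : MemLp φ 2 arcΩ) {γ : ℝ → ℝ × ℝ} (hγ : Measurable γ)
    (hle : (volume.restrict (Ioo (0 : ℝ) 1)).map γ ≤ arcΩ) :
    TendstoL2 (volume.restrict (Ioo (0 : ℝ) 1)) (fun m t => v m (γ t)) (fun t => φ (γ t)) ∧
      MemLp (fun t => φ (γ t)) 2 (volume.restrict (Ioo (0 : ℝ) 1)) := by
  have hφ' := hφ.mono_measure hle
  refine ⟨(h.mono_measure hle).congr fun m => ?_, hφ'.comp_of_map hγ.aemeasurable⟩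
  exact eLpNorm_map_measure ((hv m).aestronglyMeasurable.sub hφ'.1) hγ.aemeasurable

/-! ### The `H^{1/2}` norm of the trace -/

/-- The squared norm of the gradient. -/
noncomputable def sqGrad (v : ℝ × ℝ → ℂ) (p : ℝ × ℝ) : ℝ≥0∞ :=
  ‖fderiv ℝ v p (1, 0)‖ₑ ^ 2 + ‖fderiv ℝ v p (0, 1)‖ₑ ^ 2

theorem continuous_sqGrad {v : ℝ × ℝ → ℂ} (hv : ContDiff ℝ ∞ v) : Continuous (sqGrad v) :=
  (continuous_fderiv_apply_const hv (1, 0)).enorm_sq.add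
    (continuous_fderiv_apply_const hv (0, 1)).enorm_sq

theorem enorm_fderiv_apply_sq_le (v : ℝ × ℝ → ℂ) (p e : ℝ × ℝ) :
    ‖fderiv ℝ v p e‖ₑ ^ 2 ≤ ENNReal.ofReal (e.1 ^ 2 + e.2 ^ 2) * sqGrad v p := by
  set a := fderiv ℝ v p (1, 0)
  set b := fderiv ℝ v p (0, 1)
  have he : fderiv ℝ v p e = e.1 • a + e.2 • b := by
    rw [← map_smul, ← map_smul, ← map_add]
    congr 1
    ext <;> simp
  have hs : sqGrad v p = ENNReal.ofReal (‖a‖ ^ 2 + ‖b‖ ^ 2) := by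
    rw [ENNReal.ofReal_add (by positivity) (by positivity), ENNReal.ofReal_pow (norm_nonneg _),
      ENNReal.ofReal_pow (norm_nonneg _), ofReal_norm, ofReal_norm]
    rfl
  rw [hs, ← ENNReal.ofReal_mul (by positivity), ← ofReal_norm, ← ENNReal.ofReal_pow (norm_nonneg _)]
  refine ENNReal.ofReal_le_ofReal ?_
  have h1 : ‖fderiv ℝ v p e‖ ≤ |e.1| * ‖a‖ + |e.2| * ‖b‖ := by
    rw [he]
    refine (norm_add_le _ _).trans ?_
    rw [norm_smul, norm_smul, Real.norm_eq_abs, Real.norm_eq_abs]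
  have h2 := pow_le_pow_left₀ (norm_nonneg _) h1 2
  nlinarith [sq_nonneg (|e.1| * ‖b‖ - |e.2| * ‖a‖), sq_abs e.1, sq_abs e.2]

/-- The fundamental theorem of calculus along the chord from `q` to `p`, followed by Cauchy–Schwarz
on the unit interval. -/
theorem enorm_sub_sq_le {v : ℝ × ℝ → ℂ} (hv : ContDiff ℝ ∞ v) (p q : ℝ × ℝ) :
    ‖v p - v q‖ₑ ^ 2 ≤ ENNReal.ofReal ((p.1 - q.1) ^ 2 + (p.2 - q.2) ^ 2)
      * ∫⁻ s in Ioo (0 : ℝ) 1, sqGrad v ((1 - s) • q + s • p) := by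
  have hγ : ∀ s : ℝ, HasDerivAt (fun s : ℝ => (1 - s) • q + s • p) (p - q) s := by
    intro s
    have h1 : HasDerivAt (fun s : ℝ => 1 - s) (-1) s := by simpa using (hasDerivAt_id s).const_sub 1
    refine ((h1.smul_const q).add ((hasDerivAt_id s).smul_const p)).congr_deriv ?_
    simp
    abel
  have hd : ∀ s : ℝ, HasDerivAt (fun s : ℝ => v ((1 - s) • q + s • p))
      (fderiv ℝ v ((1 - s) • q + s • p) (p - q)) s := fun s =>
    HasFDerivAt.comp_hasDerivAt (f := fun s : ℝ => (1 - s) • q + s • p) s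
      (hv.differentiable (by simp) _).hasFDerivAt (hγ s)
  have hc : Continuous fun s : ℝ => fderiv ℝ v ((1 - s) • q + s • p) (p - q) :=
    (continuous_fderiv_apply_const hv (p - q)).comp (by fun_prop)
  have h1 := enorm_sub_le_lintegral hd hc (a := 0) (b := 1) ⟨le_rfl, zero_le_one⟩
    ⟨zero_le_one, le_rfl⟩
  simp only [sub_self, zero_smul, one_smul, zero_add, sub_zero, add_zero] at h1
  calc ‖v p - v q‖ₑ ^ 2 ≤ (∫⁻ s in Ioo (0 : ℝ) 1, ‖fderiv ℝ v ((1 - s) • q + s • p) (p - q)‖ₑ) ^ 2 :=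
        pow_le_pow_left' h1 2
    _ ≤ ∫⁻ s in Ioo (0 : ℝ) 1, ‖fderiv ℝ v ((1 - s) • q + s • p) (p - q)‖ₑ ^ 2 :=
        lintegral_enorm_sq_le hc.aestronglyMeasurable
    _ ≤ ∫⁻ s in Ioo (0 : ℝ) 1, ENNReal.ofReal ((p.1 - q.1) ^ 2 + (p.2 - q.2) ^ 2)
          * sqGrad v ((1 - s) • q + s • p) :=
        lintegral_mono fun s => enorm_fderiv_apply_sq_le v _ (p - q)
    _ = _ := lintegral_const_mul _
        ((continuous_sqGrad hv).comp (by fun_prop : Continuous fun s : ℝ => (1 - s) • q + s • p)).measurable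

/-- The integrand of the Gagliardo seminorm. -/
noncomputable def gagliardo (φ : ℝ × ℝ → ℂ) (p q : ℝ × ℝ) : ℝ≥0∞ :=
  ENNReal.ofReal (‖φ p - φ q‖ ^ 2 / ((p.1 - q.1) ^ 2 + (p.2 - q.2) ^ 2))

/-- The squared chord length cancels the singular denominator. On the diagonal the quotient is 0 by
the convention for division by zero. -/
theorem gagliardo_le {v : ℝ × ℝ → ℂ} (hv : ContDiff ℝ ∞ v) (p q : ℝ × ℝ) :
    gagliardo v p q ≤ ∫⁻ s in Ioo (0 : ℝ) 1, sqGrad v ((1 - s) • q + s • p) := by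
  unfold gagliardo
  rcases eq_or_lt_of_le (by positivity : 0 ≤ (p.1 - q.1) ^ 2 + (p.2 - q.2) ^ 2) with h0 | h0
  · rw [← h0]; simp
  · rw [ENNReal.ofReal_div_of_pos h0, ENNReal.ofReal_pow (norm_nonneg _), ofReal_norm]
    exact ENNReal.div_le_of_le_mul' (enorm_sub_sq_le hv p q)

/-- The contraction towards `r` maps `(0,1)` into itself and has Jacobian `s ≥ 1/2`, which gives the
factor 2. -/
theorem lintegral_comp_affine_le {h : ℝ → ℝ≥0∞} {r s : ℝ}
    (hr : r ∈ Icc (0 : ℝ) 1) (hs : s ∈ Icc (1 / 2 : ℝ) 1) :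
    ∫⁻ t in Ioo (0 : ℝ) 1, h ((1 - s) * r + s * t) ≤ 2 * ∫⁻ t in Ioo (0 : ℝ) 1, h t := by
  have hs0 : 0 < s := by linarith [hs.1]
  have himg := lintegral_image_eq_lintegral_abs_deriv_mul (s := Ioo (0 : ℝ) 1)
    (f := fun t => (1 - s) * r + s * t) (f' := fun _ => s) measurableSet_Ioo
    (fun x _ => by
      have := ((hasDerivAt_id x).const_mul s).const_add ((1 - s) * r)
      simpa using this.hasDerivWithinAt)
    (fun a _ b _ hab => by
      have : s * a = s * b := by simpa using hab
      exact mul_left_cancel₀ hs0.ne' this) h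
  have hsub : (fun t => (1 - s) * r + s * t) '' Ioo (0 : ℝ) 1 ⊆ Ioo 0 1 := by
    rintro _ ⟨t, ht, rfl⟩
    have h1 : 0 ≤ (1 - s) * r := mul_nonneg (by linarith [hs.2]) hr.1
    have h2 : (1 - s) * r ≤ 1 - s := mul_le_of_le_one_right (by linarith [hs.2]) hr.2
    exact ⟨by have := mul_pos hs0 ht.1; simp only; linarith,
      by have := mul_lt_of_lt_one_right hs0 ht.2; simp only; linarith⟩
  have h2 : (1 : ℝ≥0∞) ≤ 2 * ENNReal.ofReal |s| := by
    rw [abs_of_pos hs0, ← ENNReal.ofReal_ofNat 2, ← ENNReal.ofReal_mul (by norm_num),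
      ENNReal.one_le_ofReal]
    linarith [hs.1]
  calc ∫⁻ t in Ioo (0 : ℝ) 1, h ((1 - s) * r + s * t)
      ≤ ∫⁻ t in Ioo (0 : ℝ) 1, 2 * (ENNReal.ofReal |s| * h ((1 - s) * r + s * t)) := by
        refine lintegral_mono fun t => ?_
        simp only
        rw [← mul_assoc]
        exact le_mul_of_one_le_left' h2
    _ = 2 * ∫⁻ t in (fun t => (1 - s) * r + s * t) '' Ioo (0 : ℝ) 1, h t := by
        rw [himg, lintegral_const_mul' _ _ (by norm_num)]
    _ ≤ 2 * ∫⁻ t in Ioo (0 : ℝ) 1, h t := by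
        gcongr

theorem affine_mem_Icc {r s t : ℝ} (hr : r ∈ Icc (0 : ℝ) 1) (hs : s ∈ Icc (0 : ℝ) 1)
    (ht : t ∈ Icc (0 : ℝ) 1) : (1 - s) * r + s * t ∈ Icc (0 : ℝ) 1 := by
  have := (convex_Icc (0 : ℝ) 1) hr ht (sub_nonneg.2 hs.2) hs.1 (by ring)
  simpa using this

/-- A homothety centred at a point of the square preserves the two axis directions and maps the
square into itself. -/
theorem LineBound.comp_affine {w : ℝ × ℝ → ℝ≥0∞} {K : ℝ≥0∞} (h : LineBound w K)
    {r : ℝ × ℝ} (hr : r ∈ Icc (0 : ℝ) 1 ×ˢ Icc (0 : ℝ) 1) {s : ℝ} (hs : s ∈ Icc (1 / 2 : ℝ) 1) :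
    LineBound (fun p => w ((1 - s) • r + s • p)) (2 * K) := by
  have hs' : s ∈ Icc (0 : ℝ) 1 := ⟨by linarith [hs.1], hs.2⟩
  constructor
  · intro x hx
    refine (lintegral_comp_affine_le (h := fun y => w ((1 - s) * r.1 + s * x, y)) hr.2 hs).trans ?_
    gcongr
    exact h.1 _ (affine_mem_Icc hr.1 hs' hx)
  · intro y hy
    refine (lintegral_comp_affine_le (h := fun x => w (x, (1 - s) * r.2 + s * y)) hr.1 hs).trans ?_
    gcongr
    exact h.2 _ (affine_mem_Icc hr.2 hs' hy)

theorem arcΩ_univ_le : arcΩ univ ≤ 4 := by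
  have : LineBound (fun _ => 1) 1 := ⟨fun _ _ => by simp, fun _ _ => by simp⟩
  simpa using this.lintegral_arcΩ_le measurable_const

/-- The inner integral is taken over whichever endpoint has weight at least `1/2`, so the Jacobian
stays bounded below for all `s`. The constant is `4` sides, times `2` from the Jacobian, times total
length `4`. -/
theorem lintegral_affine_le {w : ℝ × ℝ → ℝ≥0∞} (hw : Continuous w) {K : ℝ≥0∞}
    (h : LineBound w K) {s : ℝ} (hs : s ∈ Ioo (0 : ℝ) 1) :
    ∫⁻ p, ∫⁻ q, w ((1 - s) • q + s • p) ∂arcΩ ∂arcΩ ≤ 32 * K := by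
  have key : ∀ s ∈ Icc (1 / 2 : ℝ) 1,
      ∫⁻ r, ∫⁻ p, w ((1 - s) • r + s • p) ∂arcΩ ∂arcΩ ≤ 32 * K := by
    intro s hs
    calc ∫⁻ r, ∫⁻ p, w ((1 - s) • r + s • p) ∂arcΩ ∂arcΩ ≤ ∫⁻ _r, 4 * (2 * K) ∂arcΩ := by
          refine lintegral_mono_ae (ae_arcΩ_mem.mono fun r hr => ?_)
          exact (h.comp_affine hr hs).lintegral_arcΩ_le
            (hw.comp (by fun_prop : Continuous fun p : ℝ × ℝ => (1 - s) • r + s • p)).measurable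
      _ ≤ 4 * (2 * K) * 4 := by
          rw [lintegral_const]
          gcongr
          exact arcΩ_univ_le
      _ = 32 * K := by ring
  rcases le_total (1 / 2) s with h2 | h2
  · rw [lintegral_lintegral_swap]
    · exact key s ⟨h2, hs.2.le⟩
    · exact (hw.comp (by fun_prop : Continuous fun z : (ℝ × ℝ) × (ℝ × ℝ) =>
        (1 - s) • z.2 + s • z.1)).measurable.aemeasurable
  · have := key (1 - s) ⟨by linarith, by linarith [hs.1]⟩
    simp only [sub_sub_cancel] at this
    simpa only [add_comm] using this

theorem lintegral_gagliardo_le {v : ℝ × ℝ → ℂ} (hv : ContDiff ℝ ∞ v) {K : ℝ≥0∞}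
    (h : LineBound (sqGrad v) K) : ∫⁻ p, ∫⁻ q, gagliardo v p q ∂arcΩ ∂arcΩ ≤ 32 * K := by
  have hw := continuous_sqGrad hv
  calc ∫⁻ p, ∫⁻ q, gagliardo v p q ∂arcΩ ∂arcΩ
      ≤ ∫⁻ p, ∫⁻ q, (∫⁻ s in Ioo (0 : ℝ) 1, sqGrad v ((1 - s) • q + s • p)) ∂arcΩ ∂arcΩ :=
        lintegral_mono fun p => lintegral_mono fun q => gagliardo_le hv p q
    _ = ∫⁻ p, (∫⁻ s in Ioo (0 : ℝ) 1, ∫⁻ q, sqGrad v ((1 - s) • q + s • p) ∂arcΩ) ∂arcΩ := by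
        refine lintegral_congr fun p => ?_
        rw [lintegral_lintegral_swap]
        exact (hw.comp (by fun_prop : Continuous fun z : (ℝ × ℝ) × ℝ =>
          (1 - z.2) • z.1 + z.2 • p)).measurable.aemeasurable
    _ = ∫⁻ s in Ioo (0 : ℝ) 1, ∫⁻ p, ∫⁻ q, sqGrad v ((1 - s) • q + s • p) ∂arcΩ ∂arcΩ := by
        rw [lintegral_lintegral_swap]
        refine Measurable.aemeasurable ?_
        exact Measurable.lintegral_prod_right' (f := fun z : ((ℝ × ℝ) × ℝ) × (ℝ × ℝ) =>
          sqGrad v ((1 - z.1.2) • z.2 + z.1.2 • z.1.1)) (hw.comp (by fun_prop)).measurable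
    _ ≤ ∫⁻ s in Ioo (0 : ℝ) 1, 32 * K := by
        refine setLIntegral_mono measurable_const fun s hs => ?_
        exact lintegral_affine_le hw h hs
    _ = 32 * K := by simp

theorem measurable_gagliardo {φ : ℝ × ℝ → ℂ} (hφ : Continuous φ) :
    Measurable fun z : (ℝ × ℝ) × (ℝ × ℝ) => gagliardo φ z.1 z.2 := by
  have h1 : Measurable fun z : (ℝ × ℝ) × (ℝ × ℝ) => ‖φ z.1 - φ z.2‖ ^ 2 :=
    (((hφ.comp continuous_fst).sub (hφ.comp continuous_snd)).norm.pow 2).measurable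
  have h2 : Measurable fun z : (ℝ × ℝ) × (ℝ × ℝ) =>
      (z.1.1 - z.2.1) ^ 2 + (z.1.2 - z.2.2) ^ 2 := by fun_prop
  exact (h1.div h2).ennreal_ofReal

theorem measurable_gagliardo_right {φ : ℝ × ℝ → ℂ} (hφ : Continuous φ) (p : ℝ × ℝ) :
    Measurable fun q => gagliardo φ p q := by
  have := (measurable_gagliardo hφ).comp (measurable_prodMk_left (x := p))
  exact this

/-- A subsequence converges a.e. on `∂Ω`, so its Gagliardo quotients converge for a.e. pair of
points; Fatou's lemma, used in `q` and then in `p`, preserves the uniform bound. -/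
theorem memHHalf_of_tendsto {v : ℕ → ℝ × ℝ → ℂ} (hv : ∀ m, ContDiff ℝ ∞ (v m))
    {φ : ℝ × ℝ → ℂ} (hφ : MemLp φ 2 arcΩ) (h : TendstoL2 arcΩ v φ) {K : ℝ≥0∞} (hK : K ≠ ⊤)
    (hb : ∀ᶠ m in atTop, LineBound (sqGrad (v m)) K) : MemHHalf φ := by
  suffices hlt : ∫⁻ p, ∫⁻ q, gagliardo φ p q ∂arcΩ ∂arcΩ < ⊤ from ⟨hφ, hlt⟩
  obtain ⟨ns, hns, hae⟩ := h.exists_seq_tendsto_ae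
    (fun m => (hv m).continuous.aestronglyMeasurable) hφ.1
  have hmeas := fun m => measurable_gagliardo (hv m).continuous
  have hlim : ∀ᵐ p ∂arcΩ, ∀ᵐ q ∂arcΩ,
      Tendsto (fun i => gagliardo (v (ns i)) p q) atTop (𝓝 (gagliardo φ p q)) := by
    filter_upwards [hae] with p hp
    filter_upwards [hae] with q hq
    exact ENNReal.tendsto_ofReal ((((hp.sub hq).norm).pow 2).div_const _)
  calc ∫⁻ p, ∫⁻ q, gagliardo φ p q ∂arcΩ ∂arcΩ
      = ∫⁻ p, ∫⁻ q, liminf (fun i => gagliardo (v (ns i)) p q) atTop ∂arcΩ ∂arcΩ := by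
        refine lintegral_congr_ae ?_
        filter_upwards [hlim] with p hp
        refine lintegral_congr_ae ?_
        filter_upwards [hp] with q hq
        exact hq.liminf_eq.symm
    _ ≤ ∫⁻ p, liminf (fun i => ∫⁻ q, gagliardo (v (ns i)) p q ∂arcΩ) atTop ∂arcΩ :=
        lintegral_mono fun p => lintegral_liminf_le fun i =>
          measurable_gagliardo_right (hv (ns i)).continuous p
    _ ≤ liminf (fun i => ∫⁻ p, ∫⁻ q, gagliardo (v (ns i)) p q ∂arcΩ ∂arcΩ) atTop :=
        lintegral_liminf_le fun i => (hmeas (ns i)).lintegral_prod_right'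
    _ ≤ 32 * K := by
        refine liminf_le_of_frequently_le' (Eventually.frequently ?_)
        filter_upwards [hns.tendsto_atTop.eventually hb] with i hi
        exact lintegral_gagliardo_le (hv (ns i)) hi
    _ < ⊤ := ENNReal.mul_lt_top (by norm_num) hK.lt_top

/-! ### The expansion of the boundary datum -/

theorem tendstoL2_expansion {μ : ℕ → ℝ} {X D : ℕ → ℝ → ℝ} (hXD : TrigSystem μ X D)
    (hX : IsCosineModule X) {g : ℝ → ℂ} (hg : MemLp g 2 (volume.restrict (Ioo (0 : ℝ) 1)))
    (hs : Summable fun n => ‖coeff X g n‖ ^ 2) :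
    TendstoL2 (volume.restrict (Ioo (0 : ℝ) 1))
      (fun M t => ∑ n ∈ Finset.range M, coeff X g n * (X n t : ℂ)) g := by
  have hXc := fun n => (hXD.contDiff_fst n).continuous
  have hc : ∀ n, Continuous fun t : ℝ => coeff X g n * (X n t : ℂ) := fun n => by
    have := hXc n; fun_prop
  have hinner : ∀ n m, ∫ x in Ioo (0 : ℝ) 1, ((X n x : ℂ) * (X m x : ℂ))
      = ((∫ x in Ioo (0 : ℝ) 1, X n x * X m x : ℝ) : ℂ) := fun n m => by
    rw [← integral_complex_ofReal]
    simp
  obtain ⟨h, hh, ht⟩ := exists_tendstoL2_of_orthogonal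
    (μ := volume.restrict (Ioo (0 : ℝ) 1)) (f := fun n t => coeff X g n * (X n t : ℂ))
    (fun n => (hc n).memLp_Ioo)
    (fun n m hnm => by
      have e : ∀ x, coeff X g m * (X m x : ℂ) * (starRingEnd ℂ) (coeff X g n * (X n x : ℂ))
          = coeff X g m * (starRingEnd ℂ) (coeff X g n) * ((X m x : ℂ) * (X n x : ℂ)) := by
        intro x
        rw [map_mul, Complex.conj_ofReal]
        ring
      simp_rw [e]
      rw [integral_const_mul, hinner, hXD.integral_mul_eq_zero hnm.symm]
      simp)
    (by
      refine Summable.of_nonneg_of_le (fun n => integral_nonneg fun _ => sq_nonneg _)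
        (fun n => ?_) (hs.mul_left 4)
      have : ∫ t in Ioo (0 : ℝ) 1, ‖coeff X g n * (X n t : ℂ)‖ ^ 2
          ≤ ∫ t in Ioo (0 : ℝ) 1, 4 * ‖coeff X g n‖ ^ 2 := by
        refine integral_mono_of_nonneg (ae_of_all _ fun _ => sq_nonneg _) (integrable_const _)
          (ae_of_all _ fun x => ?_)
        have h2 := hXD.abs_fst_le n x
        simp only
        rw [norm_mul, Complex.norm_real, mul_pow, Real.norm_eq_abs, mul_comm]
        have := pow_le_pow_left₀ (abs_nonneg _) h2 2
        nlinarith [sq_nonneg ‖coeff X g n‖]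
      simpa using this)
  refine ht.congr_right ?_
  -- The series has some `L²` limit `h`. It is identified with `g` by comparing coefficients and
  -- using completeness.
  have hcoeff : ∀ m, coeff X h m = coeff X g m := by
    intro m
    have h1 := ht.tendsto_integral_smul
      (fun M => (continuous_finsetSum (Finset.range M) fun n _ => hc n).memLp_Ioo) hh
      (ψ := X m) (hXc m).aestronglyMeasurable (B := 2) (fun x => hXD.abs_fst_le m x)
    have h2 : ∀ᶠ M in atTop, coeff X g m
        = ∫ x in Ioo (0 : ℝ) 1, X m x • ∑ n ∈ Finset.range M, coeff X g n * (X n x : ℂ) := by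
      filter_upwards [eventually_gt_atTop m] with M hM
      simp_rw [Finset.smul_sum]
      have hi : ∀ n, Integrable (fun x => X m x • (coeff X g n * (X n x : ℂ)))
          (volume.restrict (Ioo (0 : ℝ) 1)) := fun n =>
        (((hXc m).smul (hc n)).memLp_Ioo).integrable (by norm_num)
      rw [integral_finsetSum _ fun n _ => hi n, Finset.sum_eq_single_of_mem m (Finset.mem_range.2 hM)]
      · have e : ∀ x, X m x • (coeff X g m * (X m x : ℂ))
            = coeff X g m * ((X m x : ℂ) * (X m x : ℂ)) := fun x => by
          rw [Complex.real_smul]; ring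
        simp_rw [e]
        rw [integral_const_mul, hinner]
        rcases hX.normalized m with h0 | h0
        · simp [coeff, h0]
        · simp [h0]
      · intro n _ hn
        have e : ∀ x, X m x • (coeff X g n * (X n x : ℂ))
            = coeff X g n * ((X n x : ℂ) * (X m x : ℂ)) := fun x => by
          rw [Complex.real_smul]; ring
        simp_rw [e]
        rw [integral_const_mul, hinner, hXD.integral_mul_eq_zero hn]
        simp
    have h3 := tendsto_nhds_unique h1 (tendsto_const_nhds.congr' h2)
    rw [← h3]
    unfold coeff
    refine integral_congr_ae (ae_of_all _ fun x => ?_)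
    simp only
    rw [Complex.real_smul, mul_comm]
  have hz := hX.ae_eq_zero hXc hXD.abs_fst_le (hh.sub hg) fun n => by
    have hi : ∀ {f : ℝ → ℂ}, MemLp f 2 (volume.restrict (Ioo (0 : ℝ) 1)) →
        Integrable (fun x => f x * (X n x : ℂ)) (volume.restrict (Ioo (0 : ℝ) 1)) :=
      fun hf => integrableOn_mul_of_memLp hf (hXc n) (hXD.abs_fst_le n)
    have := hcoeff n
    unfold coeff at this ⊢
    simp only [Pi.sub_apply, sub_mul]
    rw [integral_sub (hi hh) (hi hg), this, sub_self]
  filter_upwards [hz] with x hx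
  exact sub_eq_zero.1 hx

/-! ### Summability of the coefficients -/

/-- The weight `ρ² l³` is `l³` for Dirichlet and `l` for Neumann, which is why the datum must lie in
`𝒳^{3/2}` or `𝒳^{1/2}`. -/
theorem exists_weight {μ : ℕ → ℝ} {X : ℕ → ℝ → ℝ} {g : ℝ → ℂ} {B₁ : HorizontalBC}
    (hgN : B₁ = HorizontalBC.neumann → MemX μ X (1 / 2) g)
    (hgD : B₁ = HorizontalBC.dirichlet → MemX μ X (3 / 2) g) :
    ∃ s : ℝ, 0 ≤ s ∧ MemX μ X s g ∧
      ∀ l m : ℝ, 0 < l → l ≤ m → profileScale B₁ l ^ 2 * l ^ 3 ≤ m ^ (2 * s) := by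
  cases B₁
  · refine ⟨3 / 2, by norm_num, hgD rfl, fun l m hl hlm => ?_⟩
    have : m ^ (2 * (3 / 2) : ℝ) = m ^ 3 := by
      rw [← Real.rpow_natCast]; norm_num
    rw [this]
    simp only [profileScale, one_pow, one_mul]
    gcongr
  · refine ⟨1 / 2, by norm_num, hgN rfl, fun l m hl hlm => ?_⟩
    have : m ^ (2 * (1 / 2) : ℝ) = m := by norm_num
    rw [this]
    simp only [profileScale]
    have : l⁻¹ ^ 2 * l ^ 3 = l := by field_simp
    rw [this]
    exact hlm

theorem profileScale_nonneg (B₁ : HorizontalBC) {l : ℝ} (hl : 0 ≤ l) : 0 ≤ profileScale B₁ l := by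
  cases B₁
  · exact zero_le_one
  · exact inv_nonneg.2 hl

/-- For large frequencies `λ = √(μ² - k²)` is comparable to `μ`. -/
theorem eventually_frequency {μ : ℕ → ℝ} (hμ : ∀ n : ℕ, (n : ℝ) * Real.pi ≤ μ n) (k : ℝ) :
    ∀ᶠ n : ℕ in atTop, 1 ≤ n ∧ 1 ≤ μ n ^ 2 - k ^ 2 ∧ 1 ≤ √(μ n ^ 2 - k ^ 2) ∧
      √(μ n ^ 2 - k ^ 2) ≤ μ n ∧ μ n ≤ 2 * √(μ n ^ 2 - k ^ 2) ∧
      (n : ℝ) ≤ √(μ n ^ 2 - k ^ 2) := by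
  obtain ⟨N, hN⟩ := exists_nat_ge (|k| + 1)
  filter_upwards [eventually_ge_atTop N] with n hn
  have h1 : |k| + 1 ≤ n := hN.trans (by exact_mod_cast hn)
  have hn1 : (1 : ℝ) ≤ n := by linarith [abs_nonneg k]
  -- With `π > 3` and `n ≥ |k| + 1`, `μₙ ≥ 3n` dominates `k` with room to spare for all the
  -- comparisons.
  have h2 : 3 * (n : ℝ) ≤ μ n := by nlinarith [hμ n, Real.pi_gt_three]
  have h3 : k ^ 2 ≤ (n : ℝ) ^ 2 := sq_le_sq' (by linarith [neg_abs_le k]) (by linarith [le_abs_self k])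
  have h4 : (3 * (n : ℝ)) ^ 2 ≤ μ n ^ 2 := by gcongr
  have h0 : 0 ≤ μ n := by linarith
  have hc : 1 ≤ μ n ^ 2 - k ^ 2 := by nlinarith
  refine ⟨by exact_mod_cast hn1, hc, Real.one_le_sqrt.2 hc, ?_, ?_, ?_⟩
  · rw [Real.sqrt_le_left h0]
    linarith [sq_nonneg k]
  · have : μ n / 2 ≤ √(μ n ^ 2 - k ^ 2) := Real.le_sqrt_of_sq_le (by nlinarith)
    linarith
  · exact Real.le_sqrt_of_sq_le (by nlinarith)

theorem summable_of_eventually_le {f g : ℕ → ℝ} (hg : Summable g) (hf : ∀ n, 0 ≤ f n)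
    (h : ∀ᶠ n in atTop, f n ≤ g n) : Summable f :=
  Summable.of_norm_bounded_eventually_nat hg
    (h.mono fun n hn => by rwa [Real.norm_of_nonneg (hf n)])

/-! ### Bounds for convergent sequences -/

theorem exists_sqNormH1_le {v : ℕ → ℝ × ℝ → ℂ} (hv : ∀ m, ContDiff ℝ ∞ (v m))
    {u ux uy : ℝ × ℝ → ℂ} (hu : MemLp u 2 areaΩ) (hux : MemLp ux 2 areaΩ) (huy : MemLp uy 2 areaΩ)
    (h : TendstoH1 v u ux uy) : ∃ K : ℝ≥0∞, K ≠ ⊤ ∧ ∀ᶠ m in atTop, sqNormH1 (v m) ≤ K := by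
  have key : ∀ {f : ℕ → ℝ × ℝ → ℂ} {g : ℝ × ℝ → ℂ}, (∀ m, Continuous (f m)) → MemLp g 2 areaΩ →
      TendstoL2 areaΩ f g → ∀ᶠ m in atTop, eLpNorm (f m) 2 areaΩ ≤ 1 + eLpNorm g 2 areaΩ := by
    intro f g hf hg hfg
    filter_upwards [Tendsto.eventually hfg (gt_mem_nhds one_pos)] with m hm
    have e : f m = (fun p => f m p - g p) + g := by ext p; simp
    rw [e]
    refine (eLpNorm_add_le ((hf m).memLp_areaΩ.sub hg).1 hg.1 (by norm_num)).trans ?_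
    exact add_le_add hm.le le_rfl
  have hne : ∀ {g : ℝ × ℝ → ℂ}, MemLp g 2 areaΩ → (1 + eLpNorm g 2 areaΩ) ^ 2 ≠ ⊤ := fun hg =>
    ENNReal.pow_ne_top (ENNReal.add_ne_top.2 ⟨by norm_num, hg.eLpNorm_ne_top⟩)
  refine ⟨(1 + eLpNorm u 2 areaΩ) ^ 2 + (1 + eLpNorm ux 2 areaΩ) ^ 2
    + (1 + eLpNorm uy 2 areaΩ) ^ 2,
    ENNReal.add_ne_top.2 ⟨ENNReal.add_ne_top.2 ⟨hne hu, hne hux⟩, hne huy⟩, ?_⟩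
  filter_upwards [key (fun m => (hv m).continuous) hu h.1,
    key (fun m => continuous_fderiv_apply_const (hv m) (1, 0)) hux h.2.1,
    key (fun m => continuous_fderiv_apply_const (hv m) (0, 1)) huy h.2.2] with m h0 h1 h2
  unfold sqNormH1
  gcongr

/-- The trace inequality on segments is applied to the components of the gradient, so second
derivatives in `L²(Ω)` control `|∇v|²` on every segment. -/
theorem exists_lineBound_sqGrad {v vx vy : ℕ → ℝ × ℝ → ℂ} (hvx : ∀ m, ContDiff ℝ ∞ (vx m))
    (hvy : ∀ m, ContDiff ℝ ∞ (vy m)) (hdx : ∀ m p, fderiv ℝ (v m) p (1, 0) = vx m p)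
    (hdy : ∀ m p, fderiv ℝ (v m) p (0, 1) = vy m p)
    {Kx Ky : ℝ≥0∞} (hx : ∀ᶠ m in atTop, sqNormH1 (vx m) ≤ Kx)
    (hy : ∀ᶠ m in atTop, sqNormH1 (vy m) ≤ Ky) :
    ∀ᶠ m in atTop, LineBound (sqGrad (v m)) (2 * Kx + 2 * Ky) := by
  filter_upwards [hx, hy] with m h1 h2
  have := ((lineBound_enorm_sq (hvx m)).mono (mul_le_mul_right h1 2)).add
    ((lineBound_enorm_sq (hvy m)).mono (mul_le_mul_right h2 2))
    (hvx m).continuous.enorm_sq.measurable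
  have e : sqGrad (v m) = fun p => ‖vx m p‖ₑ ^ 2 + ‖vy m p‖ₑ ^ 2 := by
    ext p
    rw [sqGrad, hdx, hdy]
  rwa [e]

/-- Smooth functions which converge in `H²(Ω)`: `v` with its derivatives up to second order. -/
structure ApproxH2 (v vx vy vxx vxy vyy : ℕ → ℝ × ℝ → ℂ) (u ux uy uxx uxy uyy : ℝ × ℝ → ℂ) :
    Prop where
  contDiff : ∀ m, ContDiff ℝ ∞ (v m)
  contDiff_x : ∀ m, ContDiff ℝ ∞ (vx m)
  contDiff_y : ∀ m, ContDiff ℝ ∞ (vy m)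
  fderiv_x : ∀ m p, fderiv ℝ (v m) p (1, 0) = vx m p
  fderiv_y : ∀ m p, fderiv ℝ (v m) p (0, 1) = vy m p
  fderiv_xx : ∀ m p, fderiv ℝ (vx m) p (1, 0) = vxx m p
  fderiv_xy : ∀ m p, fderiv ℝ (vx m) p (0, 1) = vxy m p
  fderiv_yx : ∀ m p, fderiv ℝ (vy m) p (1, 0) = vxy m p
  fderiv_yy : ∀ m p, fderiv ℝ (vy m) p (0, 1) = vyy m p
  memLp : MemLp u 2 areaΩ
  memLp_x : MemLp ux 2 areaΩ
  memLp_y : MemLp uy 2 areaΩ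
  memLp_xx : MemLp uxx 2 areaΩ
  memLp_xy : MemLp uxy 2 areaΩ
  memLp_yy : MemLp uyy 2 areaΩ
  tendsto : TendstoL2 areaΩ v u
  tendsto_x : TendstoL2 areaΩ vx ux
  tendsto_y : TendstoL2 areaΩ vy uy
  tendsto_xx : TendstoL2 areaΩ vxx uxx
  tendsto_xy : TendstoL2 areaΩ vxy uxy
  tendsto_yy : TendstoL2 areaΩ vyy uyy

namespace ApproxH2

variable {v vx vy vxx vxy vyy : ℕ → ℝ × ℝ → ℂ} {u ux uy uxx uxy uyy : ℝ × ℝ → ℂ}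

theorem tendstoH1 (h : ApproxH2 v vx vy vxx vxy vyy u ux uy uxx uxy uyy) : TendstoH1 v u ux uy := by
  refine ⟨h.tendsto, ?_, ?_⟩
  · simp_rw [h.fderiv_x]; exact h.tendsto_x
  · simp_rw [h.fderiv_y]; exact h.tendsto_y

theorem tendstoH1_x (h : ApproxH2 v vx vy vxx vxy vyy u ux uy uxx uxy uyy) :
    TendstoH1 vx ux uxx uxy := by
  refine ⟨h.tendsto_x, ?_, ?_⟩
  · simp_rw [h.fderiv_xx]; exact h.tendsto_xx
  · simp_rw [h.fderiv_xy]; exact h.tendsto_xy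

theorem tendstoH1_y (h : ApproxH2 v vx vy vxx vxy vyy u ux uy uxx uxy uyy) :
    TendstoH1 vy uy uxy uyy := by
  refine ⟨h.tendsto_y, ?_, ?_⟩
  · simp_rw [h.fderiv_yx]; exact h.tendsto_xy
  · simp_rw [h.fderiv_yy]; exact h.tendsto_yy

theorem exists_traces (h : ApproxH2 v vx vy vxx vxy vyy u ux uy uxx uxy uyy) :
    HasH1Gradient u ux uy ∧ HasH1Gradient ux uxx uxy ∧ HasH1Gradient uy uxy uyy ∧
    ∃ φ ψx ψy, MemLp φ 2 arcΩ ∧ MemLp ψx 2 arcΩ ∧ MemLp ψy 2 arcΩ ∧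
      TendstoL2 arcΩ v φ ∧ TendstoL2 arcΩ vy ψy ∧
      IsTrace u φ ∧ IsTrace ux ψx ∧ IsTrace uy ψy ∧ MemHHalf φ := by
  have g := hasH1Gradient_of_tendsto h.contDiff h.memLp h.memLp_x h.memLp_y h.tendstoH1
  have gx := hasH1Gradient_of_tendsto h.contDiff_x h.memLp_x h.memLp_xx h.memLp_xy h.tendstoH1_x
  have gy := hasH1Gradient_of_tendsto h.contDiff_y h.memLp_y h.memLp_xy h.memLp_yy h.tendstoH1_y
  obtain ⟨φ, hφ, tφ⟩ := exists_trace h.contDiff h.memLp h.memLp_x h.memLp_y h.tendstoH1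
  obtain ⟨ψx, hψx, tψx⟩ := exists_trace h.contDiff_x h.memLp_x h.memLp_xx h.memLp_xy h.tendstoH1_x
  obtain ⟨ψy, hψy, tψy⟩ := exists_trace h.contDiff_y h.memLp_y h.memLp_xy h.memLp_yy h.tendstoH1_y
  obtain ⟨Kx, hKx, bx⟩ :=
    exists_sqNormH1_le h.contDiff_x h.memLp_x h.memLp_xx h.memLp_xy h.tendstoH1_x
  obtain ⟨Ky, hKy, by'⟩ :=
    exists_sqNormH1_le h.contDiff_y h.memLp_y h.memLp_xy h.memLp_yy h.tendstoH1_y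
  refine ⟨g, gx, gy, φ, ψx, ψy, hφ, hψx, hψy, tφ, tψy,
    ⟨_, _, g, hφ.1, v, h.contDiff, h.tendstoH1, tφ⟩,
    ⟨_, _, gx, hψx.1, vx, h.contDiff_x, h.tendstoH1_x, tψx⟩,
    ⟨_, _, gy, hψy.1, vy, h.contDiff_y, h.tendstoH1_y, tψy⟩, ?_⟩
  exact memHHalf_of_tendsto h.contDiff hφ tφ
    (ENNReal.add_ne_top.2 ⟨ENNReal.mul_ne_top (by norm_num) hKx,
      ENNReal.mul_ne_top (by norm_num) hKy⟩)
    (exists_lineBound_sqGrad h.contDiff_x h.contDiff_y h.fderiv_x h.fderiv_y bx by')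

end ApproxH2

/-! ### The lifting -/

section Lifting

variable {k : ℝ} {B₁ B₃ : HorizontalBC} {μ : ℕ → ℝ} {X D : ℕ → ℝ → ℝ} {a : ℕ → ℂ}
  {Y Y' : ℕ → ℝ → ℂ}

/-- The squared `H²(Ω)` norm of the `n`-th term, up to a constant. -/
noncomputable def termWeight (k : ℝ) (B₁ : HorizontalBC) (μ : ℕ → ℝ) (a : ℕ → ℂ) (n : ℕ) : ℝ :=
  ‖a n‖ ^ 2 * (profileScale B₁ √(μ n ^ 2 - k ^ 2) ^ 2 * √(μ n ^ 2 - k ^ 2) ^ 3)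

/-- The exponential decay of the profiles and their derivatives. -/
def HasDecay (k : ℝ) (B₁ : HorizontalBC) (μ : ℕ → ℝ) (Y Y' : ℕ → ℝ → ℂ) : Prop :=
  ∀ n, 1 ≤ μ n ^ 2 - k ^ 2 → ∀ y ∈ Icc (0 : ℝ) 1,
    ‖Y n y‖ ≤ profileScale B₁ √(μ n ^ 2 - k ^ 2) * (4 * Real.exp (-(√(μ n ^ 2 - k ^ 2) * y))) ∧
    ‖Y' n y‖ ≤ √(μ n ^ 2 - k ^ 2) * profileScale B₁ √(μ n ^ 2 - k ^ 2)
      * (4 * Real.exp (-(√(μ n ^ 2 - k ^ 2) * y)))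

/-- The coefficients may contain up to two derivatives, hence the allowance `4 λ²`; then `16 λ⁴ ·
8ρ²/λ = 128 ρ² λ³`. Finitely many low frequencies do not matter. -/
theorem summable_profile (hμ : ∀ n : ℕ, (n : ℝ) * Real.pi ≤ μ n)
    (hw : Summable (termWeight k B₁ μ a)) (hd : HasDecay k B₁ μ Y Y') (hY : ∀ n, Continuous (Y n))
    {c : ℕ → ℂ} (hc : ∀ n, 1 ≤ √(μ n ^ 2 - k ^ 2) → √(μ n ^ 2 - k ^ 2) ≤ μ n →
      μ n ≤ 2 * √(μ n ^ 2 - k ^ 2) → ‖c n‖ ≤ ‖a n‖ * (4 * √(μ n ^ 2 - k ^ 2) ^ 2)) :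
    Summable fun n => ‖c n‖ ^ 2 * ∫ y in Ioo (0 : ℝ) 1, ‖Y n y‖ ^ 2 := by
  refine summable_of_eventually_le (hw.mul_left 128)
    (fun n => mul_nonneg (sq_nonneg _) (integral_nonneg fun _ => sq_nonneg _)) ?_
  filter_upwards [eventually_frequency hμ k] with n ⟨_, h1, h2, h3, h4, _⟩
  have hi := integral_norm_sq_le_of_exp_decay (hY n) (by linarith) fun y hy => (hd n h1 y hy).1
  have hcn := pow_le_pow_left₀ (norm_nonneg _) (hc n h2 h3 h4) 2
  unfold termWeight
  set l := √(μ n ^ 2 - k ^ 2)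
  have hl : 0 < l := by linarith
  calc _ ≤ (‖a n‖ * (4 * l ^ 2)) ^ 2 * (8 * profileScale B₁ l ^ 2 / l) := by gcongr
    _ = _ := by field_simp; ring

/-- `Y'` already costs one factor `λ`, so only one is left for the coefficients. -/
theorem summable_profile_deriv (hμ : ∀ n : ℕ, (n : ℝ) * Real.pi ≤ μ n)
    (hw : Summable (termWeight k B₁ μ a)) (hd : HasDecay k B₁ μ Y Y') (hY : ∀ n, Continuous (Y' n))
    {c : ℕ → ℂ} (hc : ∀ n, 1 ≤ √(μ n ^ 2 - k ^ 2) → √(μ n ^ 2 - k ^ 2) ≤ μ n →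
      μ n ≤ 2 * √(μ n ^ 2 - k ^ 2) → ‖c n‖ ≤ ‖a n‖ * (4 * √(μ n ^ 2 - k ^ 2))) :
    Summable fun n => ‖c n‖ ^ 2 * ∫ y in Ioo (0 : ℝ) 1, ‖Y' n y‖ ^ 2 := by
  refine summable_of_eventually_le (hw.mul_left 128)
    (fun n => mul_nonneg (sq_nonneg _) (integral_nonneg fun _ => sq_nonneg _)) ?_
  filter_upwards [eventually_frequency hμ k] with n ⟨_, h1, h2, h3, h4, _⟩
  have hi := integral_norm_sq_le_of_exp_decay (hY n) (by linarith) fun y hy => (hd n h1 y hy).2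
  have hcn := pow_le_pow_left₀ (norm_nonneg _) (hc n h2 h3 h4) 2
  unfold termWeight
  set l := √(μ n ^ 2 - k ^ 2)
  have hl : 0 < l := by linarith
  calc _ ≤ (‖a n‖ * (4 * l)) ^ 2 * (8 * (l * profileScale B₁ l) ^ 2 / l) := by gcongr
    _ = _ := by field_simp; ring

theorem summable_term (hμ : ∀ n : ℕ, (n : ℝ) * Real.pi ≤ μ n) (hX : ∀ n x, |X n x| ≤ 2)
    (hw : Summable (termWeight k B₁ μ a)) (hd : HasDecay k B₁ μ Y Y') (x : ℝ) {y : ℝ}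
    (hy : y ∈ Icc (0 : ℝ) 1) : Summable fun n => a n * (X n x : ℂ) * Y n y := by
  refine Summable.of_norm ?_
  have hsq : Summable fun n : ℕ => 1 / (n : ℝ) ^ 2 := Real.summable_one_div_nat_pow.2 (by norm_num)
  refine summable_of_eventually_le ((hw.add hsq).mul_left 4) (fun n => norm_nonneg _) ?_
  filter_upwards [eventually_frequency hμ k] with n ⟨h0, h1, h2, _, _, h5⟩
  have hb := (hd n h1 y hy).1
  unfold termWeight
  set l := √(μ n ^ 2 - k ^ 2)
  have hn : (1 : ℝ) ≤ n := by exact_mod_cast h0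
  have hρ := profileScale_nonneg B₁ (by linarith : 0 ≤ l)
  set ρ := profileScale B₁ l
  have he : Real.exp (-(l * y)) ≤ 1 :=
    Real.exp_le_one_iff.2 (neg_nonpos.2 (mul_nonneg (by linarith) hy.1))
  have hb' : ‖Y n y‖ ≤ ρ * 4 := hb.trans (by gcongr; linarith)
  rw [norm_mul, norm_mul, Complex.norm_real, Real.norm_eq_abs]
  have hl3 : (n : ℝ) ^ 2 ≤ l ^ 3 := by
    calc (n : ℝ) ^ 2 ≤ l ^ 2 := by gcongr
      _ ≤ l ^ 3 := pow_le_pow_right₀ h2 (by norm_num)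
  -- The weighted arithmetic–geometric mean inequality: the weight `n²` is absorbed by `λ³`, and the
  -- remainder `1/n²` is summable.
  have hxy : 2 * (‖a n‖ * ρ) ≤ (‖a n‖ * ρ) ^ 2 * (n : ℝ) ^ 2 + 1 / (n : ℝ) ^ 2 := by
    have h := two_mul_le_add_sq (‖a n‖ * ρ * n) (1 / n)
    have e : 2 * (‖a n‖ * ρ * n) * (1 / n) = 2 * (‖a n‖ * ρ) := by field_simp
    rw [e, mul_pow, one_div, inv_pow] at h
    rw [one_div]
    exact h
  calc ‖a n‖ * |X n x| * ‖Y n y‖ ≤ ‖a n‖ * 2 * (ρ * 4) := by gcongr; exact hX n x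
    _ = 4 * (2 * (‖a n‖ * ρ)) := by ring
    _ ≤ 4 * ((‖a n‖ * ρ) ^ 2 * (n : ℝ) ^ 2 + 1 / (n : ℝ) ^ 2) := by gcongr
    _ ≤ 4 * ((‖a n‖ * ρ) ^ 2 * l ^ 3 + 1 / (n : ℝ) ^ 2) := by gcongr
    _ = _ := by ring

/-- The separated series converges in `H²(Ω)`. -/
theorem exists_approxH2 (hXD : TrigSystem μ X D) (hμ : ∀ n : ℕ, (n : ℝ) * Real.pi ≤ μ n)
    (hw : Summable (termWeight k B₁ μ a)) (hd : HasDecay k B₁ μ Y Y')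
    (hY : ∀ n, IsSmoothProfile (μ n ^ 2 - k ^ 2) B₁ B₃ (Y n) (Y' n)) :
    ∃ u ux uy uxx uxy uyy, ApproxH2 (sepSum a X Y) (sepSum (fun n => a n * μ n) D Y)
      (sepSum a X Y') (sepSum (fun n => a n * μ n * ((-μ n : ℝ) : ℂ)) X Y)
      (sepSum (fun n => a n * μ n) D Y')
      (sepSum (fun n => a n * ((μ n ^ 2 - k ^ 2 : ℝ) : ℂ)) X Y) u ux uy uxx uxy uyy := by
  have cX := hXD.contDiff_fst
  have cD := hXD.contDiff_snd
  have cY := fun n => (hY n).contDiff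
  have cY' := fun n => (hY n).contDiff'
  have oX := fun n m (h : n ≠ m) => hXD.integral_mul_eq_zero h
  have oD := fun n m (h : n ≠ m) => hXD.swap.integral_mul_eq_zero h
  have nμ : ∀ n, 1 ≤ √(μ n ^ 2 - k ^ 2) → √(μ n ^ 2 - k ^ 2) ≤ μ n → ‖(μ n : ℂ)‖ = μ n := by
    intro n h1 h2
    rw [Complex.norm_real, Real.norm_of_nonneg (by linarith)]
  obtain ⟨u, mu, tu⟩ := exists_tendstoL2_sepSum (c := a) (fun n => (cX n).continuous)
    hXD.abs_fst_le oX (fun n => (cY n).continuous)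
    (summable_profile hμ hw hd (fun n => (cY n).continuous) fun n h1 h2 h3 =>
      le_mul_of_one_le_right (norm_nonneg _) (by nlinarith))
  obtain ⟨ux, mux, tux⟩ := exists_tendstoL2_sepSum (c := fun n => a n * μ n)
    (fun n => (cD n).continuous)
    hXD.abs_snd_le oD (fun n => (cY n).continuous)
    (summable_profile hμ hw hd (fun n => (cY n).continuous) fun n h1 h2 h3 => by
      rw [norm_mul, nμ n h1 h2]
      exact mul_le_mul_of_nonneg_left (by nlinarith) (norm_nonneg _))
  obtain ⟨uy, muy, tuy⟩ := exists_tendstoL2_sepSum (c := a) (fun n => (cX n).continuous)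
    hXD.abs_fst_le oX (fun n => (cY' n).continuous)
    (summable_profile_deriv hμ hw hd (fun n => (cY' n).continuous) fun n h1 h2 h3 =>
      le_mul_of_one_le_right (norm_nonneg _) (by nlinarith))
  obtain ⟨uxx, muxx, tuxx⟩ := exists_tendstoL2_sepSum
    (c := fun n => a n * μ n * ((-μ n : ℝ) : ℂ)) (fun n => (cX n).continuous)
    hXD.abs_fst_le oX (fun n => (cY n).continuous)
    (summable_profile hμ hw hd (fun n => (cY n).continuous) fun n h1 h2 h3 => by
      rw [norm_mul, norm_mul, Complex.ofReal_neg, norm_neg, nμ n h1 h2, mul_assoc]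
      exact mul_le_mul_of_nonneg_left (by nlinarith) (norm_nonneg _))
  obtain ⟨uxy, muxy, tuxy⟩ := exists_tendstoL2_sepSum (c := fun n => a n * μ n)
    (fun n => (cD n).continuous)
    hXD.abs_snd_le oD (fun n => (cY' n).continuous)
    (summable_profile_deriv hμ hw hd (fun n => (cY' n).continuous) fun n h1 h2 h3 => by
      rw [norm_mul, nμ n h1 h2]
      exact mul_le_mul_of_nonneg_left (by linarith) (norm_nonneg _))
  -- The differential equation replaces `Y''` by `(μ² - k²) Y`, so the second `y`-derivative is
  -- again a series in `Y`.
  obtain ⟨uyy, muyy, tuyy⟩ := exists_tendstoL2_sepSum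
    (c := fun n => a n * ((μ n ^ 2 - k ^ 2 : ℝ) : ℂ)) (fun n => (cX n).continuous)
    hXD.abs_fst_le oX (fun n => (cY n).continuous)
    (summable_profile hμ hw hd (fun n => (cY n).continuous) fun n h1 h2 h3 => by
      have h0 : 0 ≤ μ n ^ 2 - k ^ 2 := by
        by_contra! h
        rw [Real.sqrt_eq_zero_of_nonpos h.le] at h1
        linarith
      rw [norm_mul, Complex.norm_real, Real.norm_of_nonneg h0, Real.sq_sqrt h0]
      exact mul_le_mul_of_nonneg_left (by linarith) (norm_nonneg _))
  have dY : ∀ n y, HasDerivAt (Y n) (1 * Y' n y) y := fun n y => by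
    simpa using (hY n).deriv y
  refine ⟨u, ux, uy, uxx, uxy, uyy, ?_⟩
  exact
    { contDiff := contDiff_sepSum cX cY
      contDiff_x := contDiff_sepSum cD cY
      contDiff_y := contDiff_sepSum cX cY'
      fderiv_x := fderiv_sepSum_x hXD.deriv_fst cX cY
      fderiv_y := fun m p => by
        rw [fderiv_sepSum_y dY cX cY]; simp only [mul_one]
      fderiv_xx := fderiv_sepSum_x hXD.swap.deriv_fst cD cY
      fderiv_xy := fun m p => by
        rw [fderiv_sepSum_y dY cD cY]; simp only [mul_one]
      fderiv_yx := fderiv_sepSum_x hXD.deriv_fst cX cY'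
      fderiv_yy := fderiv_sepSum_y (fun n y => (hY n).deriv' y) cX cY'
      memLp := mu
      memLp_x := mux
      memLp_y := muy
      memLp_xx := muxx
      memLp_xy := muxy
      memLp_yy := muyy
      tendsto := tu
      tendsto_x := tux
      tendsto_y := tuy
      tendsto_xx := tuxx
      tendsto_xy := tuxy
      tendsto_yy := tuyy }

theorem HelmholtzLifting.HorizontalBC.eval_sum {ι : Type*} (B : HorizontalBC) (s : Finset ι) (c f f' : ι → ℂ) :
    B.eval (∑ n ∈ s, c n * f n) (∑ n ∈ s, c n * f' n) = ∑ n ∈ s, c n * B.eval (f n) (f' n) := by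
  cases B <;> rfl

theorem TendstoL2.eval {α : Type*} [MeasurableSpace α] {ν : Measure α} {f f' : ℕ → α → ℂ}
    {g g' : α → ℂ} (h : TendstoL2 ν f g) (h' : TendstoL2 ν f' g') (B : HorizontalBC) :
    TendstoL2 ν (fun m t => B.eval (f m t) (f' m t)) (fun t => B.eval (g t) (g' t)) := by
  cases B
  · exact h
  · exact h'

theorem aestronglyMeasurable_eval {α : Type*} [MeasurableSpace α] {ν : Measure α} {f f' : α → ℂ}
    (h : AEStronglyMeasurable f ν) (h' : AEStronglyMeasurable f' ν) (B : HorizontalBC) :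
    AEStronglyMeasurable (fun t => B.eval (f t) (f' t)) ν := by
  cases B
  · exact h
  · exact h'

end Lifting

/-! ### The main theorem -/

theorem mainTheorem5 (k : ℝ) (hk : 0 < k) (B₁ B₃ : HorizontalBC)
    (X : ℕ → ℝ → ℝ) (hX : IsEigenbasis (liftFreq k B₁ B₃) X)
    (g₁ : ℝ → ℂ)
    (hgN : B₁ = HorizontalBC.neumann → MemX (liftFreq k B₁ B₃) X (1 / 2) g₁)
    (hgD : B₁ = HorizontalBC.dirichlet → MemX (liftFreq k B₁ B₃) X (3 / 2) g₁) :
    -- every term is well defined: each boundary value problem has exactly one solution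
    (∀ n, ∃ Yn, IsProfile k (liftFreq k B₁ B₃ n) B₁ B₃ Yn ∧
      ∀ W, IsProfile k (liftFreq k B₁ B₃ n) B₁ B₃ W → EqOn W Yn (Icc 0 1)) ∧
    ∀ Y : ℕ → ℝ → ℂ, (∀ n, IsProfile k (liftFreq k B₁ B₃ n) B₁ B₃ (Y n)) →
      -- the series converges absolutely at each point of the closed square
      (∀ p ∈ Icc (0 : ℝ) 1 ×ˢ Icc (0 : ℝ) 1, Summable fun n => liftTerm X Y g₁ n p) ∧
      -- it defines a function in `H¹(Ω)`
      MemH1 (liftSum X Y g₁) ∧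
      ∃ ux uy uxx uxy uyy φ ψx ψy : ℝ × ℝ → ℂ,
        -- the weak derivatives of first and second order, all in `L²(Ω)`
        HasH1Gradient (liftSum X Y g₁) ux uy ∧
        HasH1Gradient ux uxx uxy ∧
        HasH1Gradient uy uxy uyy ∧
        -- the series converges in `H¹(Ω)` too
        TendstoH1 (liftPartial X Y g₁) (liftSum X Y g₁) ux uy ∧
        -- the Helmholtz equation in `Ω`
        (∀ᵐ p ∂areaΩ, uxx p + uyy p + (k : ℂ) ^ 2 * liftSum X Y g₁ p = 0) ∧
        -- the traces of `ũ`, `ũ_x` and `ũ_y`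
        IsTrace (liftSum X Y g₁) φ ∧ IsTrace ux ψx ∧ IsTrace uy ψy ∧
        -- the boundary conditions on the horizontal sides
        (∀ᵐ t ∂volume.restrict (Ioo (0 : ℝ) 1),
          B₁.eval (φ (t, 0)) (-(ψy (t, 0))) = g₁ t) ∧
        (∀ᵐ t ∂volume.restrict (Ioo (0 : ℝ) 1),
          B₃.eval (φ (t, 1)) (ψy (t, 1)) = 0) ∧
        -- the regularity of the traces
        MemHHalf φ ∧ MemLp ψx 2 arcΩ := by
  obtain ⟨hcos, D, hXD⟩ := hX.exists_trigSystem
  have hμ := hX.nat_mul_pi_le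
  have hprof := fun n => (isNonresonant_liftFreq k B₁ B₃ n).exists_isSmoothProfile
  choose Y₀ Y₀' hY₀ huniq hdecay using hprof
  refine ⟨fun n => ⟨Y₀ n, (hY₀ n).isProfile, huniq n⟩, fun Y hY => ?_⟩
  set μ := liftFreq k B₁ B₃ with hμdef
  set a := coeff X g₁ with ha
  have hd : HasDecay k B₁ μ Y₀ Y₀' := hdecay
  obtain ⟨s, hs0, ⟨hg, hgs⟩, hscale⟩ := exists_weight hgN hgD
  have hw : Summable (termWeight k B₁ μ a) := by
    refine summable_of_eventually_le hgs (fun n => by unfold termWeight; positivity) ?_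
    filter_upwards [eventually_frequency hμ k] with n ⟨_, _, h2, h3, _, _⟩
    exact mul_le_mul_of_nonneg_left (hscale _ _ (by linarith) h3) (sq_nonneg _)
  have ha2 : Summable fun n => ‖a n‖ ^ 2 := by
    refine summable_of_eventually_le hgs (fun n => sq_nonneg _) ?_
    filter_upwards [eventually_frequency hμ k] with n ⟨_, _, h2, h3, _, _⟩
    exact le_mul_of_one_le_right (sq_nonneg _)
      (Real.one_le_rpow (h2.trans h3) (by positivity))
  -- The given profiles are determined only on `[0,1]`. They are exchanged for smooth solutions on
  -- the whole line, which makes the partial sums smooth on the plane.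
  have heq : ∀ p ∈ Icc (0 : ℝ) 1 ×ˢ Icc (0 : ℝ) 1, ∀ n,
      liftTerm X Y g₁ n p = a n * (X n p.1 : ℂ) * Y₀ n p.2 := fun p hp n => by
    rw [liftTerm, huniq n (Y n) (hY n) hp.2]
  have hsum : ∀ p ∈ Icc (0 : ℝ) 1 ×ˢ Icc (0 : ℝ) 1, Summable fun n => liftTerm X Y g₁ n p :=
    fun p hp => by
      simp_rw [heq p hp]
      exact summable_term hμ hXD.abs_fst_le hw hd p.1 hp.2
  have hpart : ∀ M, ∀ p ∈ Icc (0 : ℝ) 1 ×ˢ Icc (0 : ℝ) 1,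
      liftPartial X Y g₁ M p = sepSum a X Y₀ M p := fun M p hp =>
    Finset.sum_congr rfl fun n _ => heq p hp n
  refine ⟨hsum, ?_⟩
  obtain ⟨u, ux, uy, uxx, uxy, uyy, H⟩ := exists_approxH2 hXD hμ hw hd hY₀
  have hu : u =ᵐ[areaΩ] liftSum X Y g₁ := by
    refine H.tendsto.ae_eq_of_tendsto (fun m => (H.contDiff m).continuous.aestronglyMeasurable)
      H.memLp.1 (ae_areaΩ_mem.mono fun p hp => ?_)
    exact (hsum p hp).hasSum.tendsto_sum_nat.congr fun M => hpart M p hp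
  replace H := { H with
    memLp := H.memLp.ae_eq hu
    tendsto := H.tendsto.congr_right hu : ApproxH2 _ _ _ _ _ _ (liftSum X Y g₁) ux uy uxx uxy uyy }
  obtain ⟨G, Gx, Gy, φ, ψx, ψy, hφ, hψx, hψy, tφ, tψy, Tφ, Tx, Ty, hhalf⟩ := H.exists_traces
  refine ⟨⟨ux, uy, G⟩, ux, uy, uxx, uxy, uyy, φ, ψx, ψy, G, Gx, Gy, ?_, ?_, Tφ, Tx, Ty, ?_, ?_,
    hhalf, hψx⟩
  -- `TendstoH1` involves classical gradients of the original partial sums. These agree with the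
  -- smooth ones on the open square, where equality holds near each point.
  · have hfd : ∀ M, ∀ p ∈ Ω, ∀ e, fderiv ℝ (sepSum a X Y₀ M) p e
        = fderiv ℝ (liftPartial X Y g₁ M) p e := by
      intro M p hp e
      have : sepSum a X Y₀ M =ᶠ[𝓝 p] liftPartial X Y g₁ M := by
        filter_upwards [isOpen_Ω.mem_nhds hp] with q hq
        exact (hpart M q ⟨Ioo_subset_Icc_self hq.1, Ioo_subset_Icc_self hq.2⟩).symm
      rw [this.fderiv_eq]
    have hΩ : ∀ᵐ p ∂areaΩ, p ∈ Ω := ae_restrict_mem measurableSet_Ω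
    refine ⟨TendstoL2.congr_ae H.tendsto fun m => ae_areaΩ_mem.mono fun p hp => (hpart m p hp).symm,
      TendstoL2.congr_ae H.tendstoH1.2.1 fun m => hΩ.mono fun p hp => hfd m p hp _,
      TendstoL2.congr_ae H.tendstoH1.2.2 fun m => hΩ.mono fun p hp => hfd m p hp _⟩
  · have cxx : ∀ m, Continuous (sepSum (fun n => a n * μ n * ((-μ n : ℝ) : ℂ)) X Y₀ m) := fun m =>
      (contDiff_sepSum hXD.contDiff_fst (fun n => (hY₀ n).contDiff) m).continuous
    have cyy : ∀ m, Continuous (sepSum (fun n => a n * ((μ n ^ 2 - k ^ 2 : ℝ) : ℂ)) X Y₀ m) :=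
      fun m => (contDiff_sepSum hXD.contDiff_fst (fun n => (hY₀ n).contDiff) m).continuous
    have c0 := fun m => (H.contDiff m).continuous
    have t := (H.tendsto_xx.add H.tendsto_yy (fun m => (cxx m).memLp_areaΩ)
      (fun m => (cyy m).memLp_areaΩ) H.memLp_xx H.memLp_yy).add (H.tendsto.const_mul ((k : ℂ) ^ 2))
      (fun m => ((cxx m).add (cyy m)).memLp_areaΩ)
      (fun m => (continuous_const.mul (c0 m)).memLp_areaΩ) (H.memLp_xx.add H.memLp_yy)
      (H.memLp.const_mul _)
    -- Termwise cancellation: `-μ² + (μ² - k²) + k² = 0`.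
    have hz : ∀ m p, sepSum (fun n => a n * μ n * ((-μ n : ℝ) : ℂ)) X Y₀ m p
        + sepSum (fun n => a n * ((μ n ^ 2 - k ^ 2 : ℝ) : ℂ)) X Y₀ m p
        + (k : ℂ) ^ 2 * sepSum a X Y₀ m p = 0 := by
      intro m p
      unfold sepSum
      rw [Finset.mul_sum, ← Finset.sum_add_distrib, ← Finset.sum_add_distrib]
      refine Finset.sum_eq_zero fun n _ => ?_
      push_cast
      ring
    simp_rw [hz] at t
    exact t.ae_eq_of_tendsto (g' := fun _ => 0) (fun m => aestronglyMeasurable_const)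
      ((H.memLp_xx.add H.memLp_yy).add (H.memLp.const_mul _)).1
      (ae_of_all _ fun p => tendsto_const_nhds)
  · obtain ⟨t1, m1⟩ := tφ.comp_of_map_le (fun m => (H.contDiff m).continuous) hφ
      (γ := fun t => (t, 0)) (by fun_prop) map_bottom_le_arcΩ
    obtain ⟨t2, m2⟩ := tψy.comp_of_map_le (fun m => (H.contDiff_y m).continuous) hψy
      (γ := fun t => (t, 0)) (by fun_prop) map_bottom_le_arcΩ
    have t3 := t1.eval (by simpa using t2.const_mul (-1)) B₁
    -- Since `B₁ Yₙ(0) = 1`, the boundary values on `Γ₁` are exactly the partial sums of the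
    -- expansion of `g₁`; two `L²` limits of one sequence coincide.
    have e : ∀ m t, B₁.eval (sepSum a X Y₀ m (t, 0)) (-sepSum a X Y₀' m (t, 0))
        = ∑ n ∈ Finset.range m, a n * (X n t : ℂ) := by
      intro m t
      unfold sepSum
      rw [← Finset.sum_neg_distrib]
      simp_rw [← mul_neg]
      rw [HorizontalBC.eval_sum]
      exact Finset.sum_congr rfl fun n _ => by rw [(hY₀ n).bc_zero, mul_one]
    simp_rw [e] at t3
    exact t3.unique (tendstoL2_expansion hXD hcos hg ha2)
      (fun m => (continuous_finsetSum _ fun n _ => continuous_const.mul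
        (Complex.continuous_ofReal.comp (hXD.contDiff_fst n).continuous)).aestronglyMeasurable)
      (aestronglyMeasurable_eval m1.1 m2.1.neg B₁) hg.1
  · obtain ⟨t1, m1⟩ := tφ.comp_of_map_le (fun m => (H.contDiff m).continuous) hφ
      (γ := fun t => (t, 1)) (by fun_prop) map_top_le_arcΩ
    obtain ⟨t2, m2⟩ := tψy.comp_of_map_le (fun m => (H.contDiff_y m).continuous) hψy
      (γ := fun t => (t, 1)) (by fun_prop) map_top_le_arcΩ
    have t3 := t1.eval t2 B₃
    have e : ∀ m t, B₃.eval (sepSum a X Y₀ m (t, 1)) (sepSum a X Y₀' m (t, 1)) = 0 := by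
      intro m t
      unfold sepSum
      rw [HorizontalBC.eval_sum]
      exact Finset.sum_eq_zero fun n _ => by rw [(hY₀ n).bc_one, mul_zero]
    simp_rw [e] at t3
    exact t3.ae_eq_of_tendsto (g' := fun _ => 0) (fun m => aestronglyMeasurable_const)
      (aestronglyMeasurable_eval m1.1 m2.1 B₃) (ae_of_all _ fun p => tendsto_const_nhds)
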